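/- Let $A$ be a finite-dimensional algebra over a field $K$. Modules are finite-dimensional right $A$-modules. The dominant dimension of a module $M$ with minimal injective resolution $0\to M\to I_0\to I_1\to\cdots$ is $\sup\{n\ge 0 : I_i \text{ is projective for } i=0,\dots,n\}+1\in\{1,2,\dots,\infty\}$ if $I_0$ is projective, and $0$ otherwise; the dominant dimension of $A$ is that of the right module $A_A$. Write $\mathrm{Dom}_n$ for the class of modules of dominant dimension at least $n$. A module $M$ is called Gorenstein projective if $\mathrm{Ext}^i_A(M,A)=0=\mathrm{Ext}^i_{A^{op}}(\mathrm{Tr}(M),A)$ for all $i\ge 1$, where the transpose $\mathrm{Tr}(M)$ is the left module $\mathrm{coker}(\mathrm{Hom}_A(P_0,A)\to \mathrm{Hom}_A(P_1,A))$ for a minimal projective presentation $P_1\to P_0\to M\to 0$; write $Gp(A)$ for the class of Gorenstein projective modules. The algebra $A$ is Gorenstein with Gorenstein dimension $g\in\mathbb{N}$ if the injective dimensions of $A$ as a left module and as a right module are both equal to $g$. Suppose that $A$ has (finite) dominant dimension $d\ge 1$. Then the following two statements are equivalent: (1) $Gp(A)=\mathrm{Dom}_d$; (2) $A$ is Gorenstein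 with Gorenstein dimension $d$. -/

import Mathlib

universe u v

open CategoryTheory

namespace GorDom

/-- A submodule `N` of `M` is essential: it meets every nonzero submodule nontrivially. -/
def IsEssentialSubmodule {R M : Type*} [Ring R] [AddCommGroup M] [Module R M]
    (N : Submodule R M) : Prop :=
  ∀ L : Submodule R M, N ⊓ L = ⊥ → L = ⊥

/-- A submodule `N` of `M` is superfluous (small): `N + L = M` forces `L = M`. -/
def IsSuperfluousSubmodule {R M : Type*} [Ring R] [AddCommGroup M] [Module R M]
    (N : Submodule R M) : Prop :=
  ∀ L : Submodule R M, N ⊔ L = ⊤ → L = ⊤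

/-- An injective resolution `0 → M → I₀ → I₁ → ⋯` is minimal if `Iᵢ` is an essential extension
(i.e. an injective hull) of the kernel of `Iᵢ → Iᵢ₊₁` for every `i`. By exactness this kernel is
the image of `M` if `i = 0`, and the image of `Iᵢ₋₁` otherwise. -/
def IsMinimalResolution {R : Type u} [Ring R] {M : ModuleCat.{u} R}
    (I : InjectiveResolution M) : Prop :=
  ∀ i : ℕ, IsEssentialSubmodule (LinearMap.ker (I.cocomplex.d i (i + 1)).hom)

/-- The dominant dimension of a module `M`: the supremum of all `k` such that the first `k` terms
`I₀, …, Iₖ₋₁` of a minimal injective resolution of `M` are projective. Minimal injective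
resolutions are unique up to isomorphism. -/
noncomputable def domdim {R : Type u} [Ring R] (M : ModuleCat.{u} R) : ℕ∞ :=
  sSup {n : ℕ∞ | ∃ k : ℕ, n = k ∧ ∃ I : InjectiveResolution M, IsMinimalResolution I ∧
    ∀ i < k, Module.Projective R (I.cocomplex.X i)}

/-- The regular right module `A_A`. Right `A`-modules are modules over `Aᵐᵒᵖ`. -/
abbrev rightRegular (A : Type u) [Ring A] : ModuleCat.{u} Aᵐᵒᵖ := ModuleCat.of Aᵐᵒᵖ A

/-- The regular left module `_A A`. -/
abbrev leftRegular (A : Type u) [Ring A] : ModuleCat.{u} A := ModuleCat.of A A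

/-- The dominant dimension of an algebra is that of its regular right module. -/
noncomputable def algDomdim (A : Type u) [Ring A] : ℕ∞ := domdim (rightRegular A)

/-- `Dom_n(A)`: the finitely generated right `A`-modules of dominant dimension at least `n`. Over
a finite-dimensional algebra, finitely generated is the same as finite-dimensional. -/
def Dom (A : Type u) [Ring A] (n : ℕ∞) : ObjectProperty (ModuleCat.{u} Aᵐᵒᵖ) :=
  fun M => Module.Finite Aᵐᵒᵖ M ∧ n ≤ domdim M

/-- A minimal projective presentation `P₁ → P₀ → M → 0` of the right `A`-module `M`: an exact
sequence in which `P₀ → M` and `P₁ → ker (P₀ → M)` are projective covers. -/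
structure MinimalPresentation {A : Type u} [Ring A] (M : ModuleCat.{u} Aᵐᵒᵖ) where
  P₁ : ModuleCat.{u} Aᵐᵒᵖ
  P₀ : ModuleCat.{u} Aᵐᵒᵖ
  projective₁ : Module.Projective Aᵐᵒᵖ P₁
  projective₀ : Module.Projective Aᵐᵒᵖ P₀
  f : P₁ →ₗ[Aᵐᵒᵖ] P₀
  π : P₀ →ₗ[Aᵐᵒᵖ] M
  surjective : Function.Surjective π
  exact : LinearMap.range f = LinearMap.ker π
  superfluous₀ : IsSuperfluousSubmodule (LinearMap.ker π)
  superfluous₁ : IsSuperfluousSubmodule (LinearMap.ker f)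

/-- The transpose `Tr M`: the left `A`-module which is the cokernel of
`Hom_A(f, A) : Hom_A(P₀, A) → Hom_A(P₁, A)`, for a minimal projective presentation
`P₁ → P₀ → M → 0` with first map `f`. -/
noncomputable def MinimalPresentation.transpose {A : Type u} [Ring A] {M : ModuleCat.{u} Aᵐᵒᵖ}
    (p : MinimalPresentation M) : ModuleCat.{u} A :=
  ModuleCat.of A ((p.P₁ →ₗ[Aᵐᵒᵖ] A) ⧸ LinearMap.range (LinearMap.lcomp A A p.f))

/-- `Gp(A)`: the finitely generated right `A`-modules `M` with
`Extⁱ(M, A) = 0 = Extⁱ(Tr M, A)` for all `i ≥ 1`, where the first `Ext` is over right modules and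
the second one over left modules. Minimal projective presentations exist over finite-dimensional
algebras and are unique up to isomorphism. -/
def Gp (A : Type u) [Ring A] : ObjectProperty (ModuleCat.{u} Aᵐᵒᵖ) :=
  fun M => Module.Finite Aᵐᵒᵖ M ∧
    (∀ i : ℕ, 1 ≤ i → Subsingleton (Abelian.Ext M (rightRegular A) i)) ∧
    ∃ p : MinimalPresentation M,
      ∀ i : ℕ, 1 ≤ i → Subsingleton (Abelian.Ext p.transpose (leftRegular A) i)

/-- `A` is Gorenstein of Gorenstein dimension `g`: the left and the right injective dimension of
`A` are both equal to the natural number `g`. -/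
def IsGorensteinOfDim (A : Type u) [Ring A] (g : ℕ) : Prop :=
  injectiveDimension (leftRegular A) = g ∧ injectiveDimension (rightRegular A) = g

end GorDom

/-! Call a right module torsion if it has no nonzero map to a projective-injective module. The proof
is dimension shifting, once dominant dimension is put homologically: a finitely generated M has
dominant dimension at least n exactly when Extⁱ(T, M) = 0 for all torsion T and all i < n
(`domGE_of_le_domdim`, `le_domdim_of_domGE`). In this form a syzygy gains one, up to the bound d
that A imposes (`DomGE.of_ses`), and the cokernel of an injective hull loses one (`DomGE.hull`).

A Gorenstein projective module embeds into a free module with Gorenstein projective cokernel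
(`IsGProj.exists_cosyzygy`). Iterating this d times gives Gp ⊆ Dom_d, with no Gorenstein hypothesis
(`IsGProj.domGE`).

If A is Gorenstein of dimension d and M lies in Dom_d, the first d terms of its minimal injective
resolution are projective, so the groups Extⁱ(M, A) are shifted into degrees above d, where they
vanish (`extVanish_of_domGE`). Those of Tr M are then shifted along syzygies of M into degrees above
the left injective dimension (`extVanish_Tr`).

Conversely, let Gp = Dom_d. A d-th syzygy of any finitely generated module lies in Dom_d = Gp, so
the right injective dimension is at most d. Let D be the K-dual. The injective module D(A) is right
Ext-orthogonal to Gp, and so are its syzygies. Its d-th syzygy also lies in Gp, so its embedding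
into a free module splits and it is projective. Hence D(A) has projective dimension at most d, which
by duality bounds the left injective dimension. Both dimensions are at least d: a smaller right one
would make A projective-injective, of infinite dominant dimension
(`projective_and_injective_of_domGE`), and a smaller left one would force a smaller right one
(`not_hasInjectiveDimensionLT_left`). -/

namespace GorDom

open Abelian

/-! ### Vanishing of Ext along short exact sequences, retracts and finite powers. -/

section ExtToolkit

variable {R : Type u} [Ring R]

/-- `Extⁱ(M, N) = 0`. -/
abbrev ExtVanish (R : Type u) [Ring R] (M N : Type u) [AddCommGroup M] [Module R M]
    [AddCommGroup N] [Module R N] (i : ℕ) : Prop :=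
  Subsingleton (Ext (ModuleCat.of R M) (ModuleCat.of R N) i)

variable {M₁ M₂ M₃ X Y : Type u} [AddCommGroup M₁] [Module R M₁] [AddCommGroup M₂] [Module R M₂]
  [AddCommGroup M₃] [Module R M₃] [AddCommGroup X] [Module R X] [AddCommGroup Y] [Module R Y]
  {f : M₁ →ₗ[R] M₂} {g : M₂ →ₗ[R] M₃}

/-- The exact sequence `0 → M₁ → M₂ → M₃ → 0`. -/
structure IsSES (f : M₁ →ₗ[R] M₂) (g : M₂ →ₗ[R] M₃) : Prop where
  inj : Function.Injective f
  surj : Function.Surjective g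
  exact : Function.Exact f g

namespace IsSES

/-- The short complex attached to a short exact sequence of modules. -/
abbrev complex (h : IsSES f g) : ShortComplex (ModuleCat.{u} R) :=
  ModuleCat.shortComplexOfCompEqZero f g h.exact.linearMap_comp_eq_zero

lemma shortExact (h : IsSES f g) : h.complex.ShortExact :=
  ModuleCat.shortComplex_shortExact _ h.exact h.inj h.surj

lemma of_range_eq_ker (hf : Function.Injective f) (hg : Function.Surjective g)
    (h : LinearMap.range f = LinearMap.ker g) : IsSES f g :=
  ⟨hf, hg, LinearMap.exact_iff.2 h.symm⟩

lemma mkQ {f : M₁ →ₗ[R] M₂} (hf : Function.Injective f) :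
    IsSES f (LinearMap.range f).mkQ :=
  ⟨hf, Submodule.mkQ_surjective _, LinearMap.exact_map_mkQ_range f⟩

lemma subtype_mkQ (N : Submodule R M₂) : IsSES N.subtype N.mkQ :=
  ⟨N.injective_subtype, N.mkQ_surjective, LinearMap.exact_subtype_mkQ N⟩

lemma ker {g : M₂ →ₗ[R] M₃} (hg : Function.Surjective g) :
    IsSES (LinearMap.ker g).subtype g :=
  ⟨Submodule.injective_subtype _, hg, LinearMap.exact_subtype_ker_map g⟩

lemma covariant₁ (h : IsSES f g) {i : ℕ} (h₃ : ExtVanish R X M₃ i)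
    (h₂ : ExtVanish R X M₂ (i + 1)) : ExtVanish R X M₁ (i + 1) := by
  refine ⟨fun a b => ?_⟩
  obtain ⟨c, hc⟩ := Ext.covariant_sequence_exact₁ (ModuleCat.of R X) h.shortExact (a - b)
    (h₂.elim _ _) (n₀ := i) rfl
  rw [h₃.elim c 0, Ext.zero_comp] at hc
  exact sub_eq_zero.1 hc.symm

lemma covariant₂ (h : IsSES f g) {i : ℕ} (h₁ : ExtVanish R X M₁ i)
    (h₃ : ExtVanish R X M₃ i) : ExtVanish R X M₂ i := by
  refine ⟨fun a b => ?_⟩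
  obtain ⟨c, hc⟩ := Ext.covariant_sequence_exact₂ (ModuleCat.of R X) h.shortExact (a - b)
    (h₃.elim _ _)
  rw [h₁.elim c 0, Ext.zero_comp] at hc
  exact sub_eq_zero.1 hc.symm

lemma covariant₃ (h : IsSES f g) {i : ℕ} (h₂ : ExtVanish R X M₂ i)
    (h₁ : ExtVanish R X M₁ (i + 1)) : ExtVanish R X M₃ i := by
  refine ⟨fun a b => ?_⟩
  obtain ⟨c, hc⟩ := Ext.covariant_sequence_exact₃ (ModuleCat.of R X) h.shortExact (a - b) rfl
    (h₁.elim _ _)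
  rw [h₂.elim c 0, Ext.zero_comp] at hc
  exact sub_eq_zero.1 hc.symm

lemma contravariant₁ (h : IsSES f g) {i : ℕ} (h₂ : ExtVanish R M₂ Y i)
    (h₃ : ExtVanish R M₃ Y (i + 1)) : ExtVanish R M₁ Y i := by
  refine ⟨fun a b => ?_⟩
  obtain ⟨c, hc⟩ := Ext.contravariant_sequence_exact₁ h.shortExact (ModuleCat.of R Y) (a - b)
    (add_comm 1 i) (h₃.elim _ _)
  rw [h₂.elim c 0, Ext.comp_zero] at hc
  exact sub_eq_zero.1 hc.symm

lemma contravariant₂ (h : IsSES f g) {i : ℕ} (h₁ : ExtVanish R M₁ Y i)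
    (h₃ : ExtVanish R M₃ Y i) : ExtVanish R M₂ Y i := by
  refine ⟨fun a b => ?_⟩
  obtain ⟨c, hc⟩ := Ext.contravariant_sequence_exact₂ h.shortExact (ModuleCat.of R Y) (a - b)
    (h₁.elim _ _)
  rw [h₃.elim c 0, Ext.comp_zero] at hc
  exact sub_eq_zero.1 hc.symm

lemma contravariant₃ (h : IsSES f g) {i : ℕ} (h₁ : ExtVanish R M₁ Y i)
    (h₂ : ExtVanish R M₂ Y (i + 1)) : ExtVanish R M₃ Y (i + 1) := by
  refine ⟨fun a b => ?_⟩
  obtain ⟨c, hc⟩ := Ext.contravariant_sequence_exact₃ h.shortExact (ModuleCat.of R Y) (a - b)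
    (h₂.elim _ _) (add_comm 1 i)
  rw [h₁.elim c 0, Ext.comp_zero] at hc
  exact sub_eq_zero.1 hc.symm

end IsSES

lemma extVanish_zero_iff : ExtVanish R X Y 0 ↔ ∀ φ : X →ₗ[R] Y, φ = 0 := by
  refine ⟨fun h φ => ?_, fun h => ⟨fun a b => ?_⟩⟩
  · have := h.elim (Ext.mk₀ (ModuleCat.ofHom φ)) (Ext.mk₀ 0)
    have := (Ext.mk₀_bijective _ _).1 this
    simpa using congrArg ModuleCat.Hom.hom this
  · obtain ⟨a, rfl⟩ := (Ext.mk₀_bijective _ _).2 a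
    obtain ⟨b, rfl⟩ := (Ext.mk₀_bijective _ _).2 b
    congr 1
    ext1
    rw [h a.hom, h b.hom]

namespace IsSES

lemma covariant_zero (h : IsSES f g) (h₂ : ExtVanish R X M₂ 0) : ExtVanish R X M₁ 0 := by
  rw [extVanish_zero_iff] at h₂ ⊢
  intro φ
  ext x
  exact h.inj (by simpa using LinearMap.congr_fun (h₂ (f ∘ₗ φ)) x)

lemma extend_of_extVanish (h : IsSES f g) (h₃ : ExtVanish R M₃ Y 1) (φ : M₁ →ₗ[R] Y) :
    ∃ ψ : M₂ →ₗ[R] Y, ψ ∘ₗ f = φ := by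
  obtain ⟨c, hc⟩ := Ext.contravariant_sequence_exact₁ h.shortExact (ModuleCat.of R Y)
    (Ext.mk₀ (ModuleCat.ofHom φ)) (add_zero 1) (h₃.elim _ _)
  obtain ⟨c, rfl⟩ := (Ext.mk₀_bijective _ _).2 c
  rw [Ext.mk₀_comp_mk₀] at hc
  exact ⟨c.hom, congrArg ModuleCat.Hom.hom ((Ext.mk₀_bijective _ _).1 hc)⟩

lemma extVanish_of_extend (h : IsSES f g) (h₂ : ExtVanish R M₂ Y 1)
    (H : ∀ φ : M₁ →ₗ[R] Y, ∃ ψ : M₂ →ₗ[R] Y, ψ ∘ₗ f = φ) : ExtVanish R M₃ Y 1 := by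
  refine ⟨fun a b => ?_⟩
  obtain ⟨c, hc⟩ := Ext.contravariant_sequence_exact₃ h.shortExact (ModuleCat.of R Y) (a - b)
    (h₂.elim _ _) (add_zero 1)
  obtain ⟨c, rfl⟩ := (Ext.mk₀_bijective _ _).2 c
  obtain ⟨ψ, hψ⟩ := H c.hom
  have : c = h.complex.f ≫ ModuleCat.ofHom ψ := by ext1; exact hψ.symm
  rw [this, ← Ext.mk₀_comp_mk₀, ShortComplex.ShortExact.extClass_comp_assoc] at hc
  exact sub_eq_zero.1 hc.symm

lemma lift_of_extVanish (h : IsSES f g) (h₁ : ExtVanish R X M₁ 1) (φ : X →ₗ[R] M₃) :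
    ∃ ψ : X →ₗ[R] M₂, g ∘ₗ ψ = φ := by
  obtain ⟨c, hc⟩ := Ext.covariant_sequence_exact₃ (ModuleCat.of R X) h.shortExact
    (Ext.mk₀ (ModuleCat.ofHom φ)) (zero_add 1) (h₁.elim _ _)
  obtain ⟨c, rfl⟩ := (Ext.mk₀_bijective _ _).2 c
  rw [Ext.mk₀_comp_mk₀] at hc
  exact ⟨c.hom, congrArg ModuleCat.Hom.hom ((Ext.mk₀_bijective _ _).1 hc)⟩

lemma extVanish_of_lift (h : IsSES f g) (h₂ : ExtVanish R X M₂ 1)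
    (H : ∀ φ : X →ₗ[R] M₃, ∃ ψ : X →ₗ[R] M₂, g ∘ₗ ψ = φ) : ExtVanish R X M₁ 1 := by
  refine ⟨fun a b => ?_⟩
  obtain ⟨c, hc⟩ := Ext.covariant_sequence_exact₁ (ModuleCat.of R X) h.shortExact (a - b)
    (h₂.elim _ _) (zero_add 1)
  obtain ⟨c, rfl⟩ := (Ext.mk₀_bijective _ _).2 c
  obtain ⟨ψ, hψ⟩ := H c.hom
  have : c = ModuleCat.ofHom ψ ≫ h.complex.g := by ext1; exact hψ.symm
  rw [this, ← Ext.mk₀_comp_mk₀, Ext.comp_assoc_of_second_deg_zero,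
    ShortComplex.ShortExact.comp_extClass, Ext.comp_zero] at hc
  exact sub_eq_zero.1 hc.symm

end IsSES

lemma extVanish_of_projective [Module.Projective R X] (i : ℕ) : ExtVanish R X Y (i + 1) :=
  have : Projective (ModuleCat.of R X) := (IsProjective.iff_projective X).1 ‹_›
  ⟨fun _ _ => (Ext.eq_zero_of_projective _).trans (Ext.eq_zero_of_projective _).symm⟩

lemma extVanish_of_injective [Module.Injective R Y] (i : ℕ) : ExtVanish R X Y (i + 1) :=
  have : Injective (ModuleCat.of R Y) := (Module.injective_iff_injective_object R Y).1 ‹_›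
  ⟨fun _ _ => (Ext.eq_zero_of_injective _).trans (Ext.eq_zero_of_injective _).symm⟩

lemma extVanish_of_pos_of_projective [Module.Projective R X] {i : ℕ} (hi : 1 ≤ i) :
    ExtVanish R X Y i := by
  obtain ⟨i, rfl⟩ := Nat.exists_eq_add_of_le' hi
  exact extVanish_of_projective i

lemma extVanish_of_pos_of_injective [Module.Injective R Y] {i : ℕ} (hi : 1 ≤ i) :
    ExtVanish R X Y i := by
  obtain ⟨i, rfl⟩ := Nat.exists_eq_add_of_le' hi
  exact extVanish_of_injective i

lemma ExtVanish.retract_left {X' : Type u} [AddCommGroup X'] [Module R X'] {i : ℕ}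
    (h : ExtVanish R X Y i) (s : X' →ₗ[R] X) (r : X →ₗ[R] X') (hrs : r ∘ₗ s = LinearMap.id) :
    ExtVanish R X' Y i := by
  refine ⟨fun a b => ?_⟩
  have key (a : Ext (ModuleCat.of R X') (ModuleCat.of R Y) i) :
      a = (Ext.mk₀ (ModuleCat.ofHom s)).comp
      ((Ext.mk₀ (ModuleCat.ofHom r)).comp a (zero_add i)) (zero_add i) := by
    rw [Ext.mk₀_comp_mk₀_assoc, ← ModuleCat.ofHom_comp, hrs, ModuleCat.ofHom_id, Ext.mk₀_id_comp]
  rw [key a, key b, h.elim (Ext.comp _ a _) (Ext.comp _ b _)]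

lemma ExtVanish.retract_right {Y' : Type u} [AddCommGroup Y'] [Module R Y'] {i : ℕ}
    (h : ExtVanish R X Y i) (s : Y' →ₗ[R] Y) (r : Y →ₗ[R] Y') (hrs : r ∘ₗ s = LinearMap.id) :
    ExtVanish R X Y' i := by
  refine ⟨fun a b => ?_⟩
  have key (a : Ext (ModuleCat.of R X) (ModuleCat.of R Y') i) :
      a = (a.comp (Ext.mk₀ (ModuleCat.ofHom s)) (add_zero i)).comp
        (Ext.mk₀ (ModuleCat.ofHom r)) (add_zero i) := by
    rw [Ext.comp_assoc_of_third_deg_zero, Ext.mk₀_comp_mk₀, ← ModuleCat.ofHom_comp, hrs,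
      ModuleCat.ofHom_id, Ext.comp_mk₀_id]
  rw [key a, key b, h.elim (Ext.comp a _ _) (Ext.comp b _ _)]

lemma ExtVanish.congr_right {Y' : Type u} [AddCommGroup Y'] [Module R Y'] {i : ℕ}
    (h : ExtVanish R X Y i) (e : Y' ≃ₗ[R] Y) : ExtVanish R X Y' i :=
  h.retract_right e.toLinearMap e.symm.toLinearMap (by ext; simp)

lemma isSES_pi_succ (M : Type u) [AddCommGroup M] [Module R M] (n : ℕ) :
    IsSES (LinearMap.single R (fun _ : Fin (n + 1) => M) 0)
      (LinearMap.funLeft R M (Fin.succ : Fin n → Fin (n + 1))) where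
  inj := Pi.single_injective (M := fun _ : Fin (n + 1) => M) 0
  surj := LinearMap.funLeft_surjective_of_injective _ _ _ (Fin.succ_injective n)
  exact := by
    intro y
    constructor
    · intro h
      refine ⟨y 0, funext fun i => ?_⟩
      refine Fin.cases (by simp) (fun j => ?_) i
      simpa [Fin.succ_ne_zero] using (congrFun h j).symm
    · rintro ⟨m, rfl⟩
      ext j
      simp [LinearMap.funLeft_apply, Fin.succ_ne_zero]

lemma ExtVanish.pi_left {i : ℕ} (h : ExtVanish R X Y i) (n : ℕ) :
    ExtVanish R (Fin n → X) Y i := by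
  induction n with
  | zero =>
    refine h.retract_left (0 : (Fin 0 → X) →ₗ[R] X) 0 ?_
    exact LinearMap.ext fun _ => Subsingleton.elim _ _
  | succ n ih => exact (isSES_pi_succ X n).contravariant₂ h ih

lemma ExtVanish.pi_right {i : ℕ} (h : ExtVanish R X Y i) (n : ℕ) :
    ExtVanish R X (Fin n → Y) i := by
  induction n with
  | zero =>
    refine h.retract_right (0 : (Fin 0 → Y) →ₗ[R] Y) 0 ?_
    exact LinearMap.ext fun _ => Subsingleton.elim _ _
  | succ n ih => exact (isSES_pi_succ Y n).covariant₂ h ih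

lemma exists_retract_of_finite_projective (R : Type u) [Ring R] (P : Type u) [AddCommGroup P]
    [Module R P] [Module.Finite R P] [Module.Projective R P] :
    ∃ (n : ℕ) (s : P →ₗ[R] (Fin n → R)) (r : (Fin n → R) →ₗ[R] P), r ∘ₗ s = LinearMap.id := by
  obtain ⟨n, r, s, -, -, h⟩ := Module.Finite.exists_comp_eq_id_of_projective R P
  exact ⟨n, s, r, h⟩

lemma ExtVanish.of_finite_projective {P : Type u} [AddCommGroup P] [Module R P]
    [Module.Finite R P] [Module.Projective R P] {i : ℕ} (h : ExtVanish R X R i) :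
    ExtVanish R X P i := by
  obtain ⟨n, s, r, hrs⟩ := exists_retract_of_finite_projective R P
  exact (h.pi_right n).retract_right s r hrs

end ExtToolkit

/-! ### Finitely generated injective hulls and projective covers. -/

section Hulls

variable {R : Type u} [Ring R]

lemma injective_of_retract {E F : Type u} [AddCommGroup E] [Module R E] [AddCommGroup F]
    [Module R F] [Module.Injective R E] (s : F →ₗ[R] E) (r : E →ₗ[R] F)
    (hrs : r ∘ₗ s = LinearMap.id) : Module.Injective R F where
  out X Y _ _ _ _ f hf g := by
    obtain ⟨h, hh⟩ := Module.Injective.out f hf (s ∘ₗ g)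
    refine ⟨r ∘ₗ h, fun x => ?_⟩
    simpa [hh] using LinearMap.congr_fun hrs (g x)

lemma injective_prod {E F : Type u} [AddCommGroup E] [Module R E] [AddCommGroup F]
    [Module R F] [Module.Injective R E] [Module.Injective R F] : Module.Injective R (E × F) where
  out X Y _ _ _ _ f hf g := by
    obtain ⟨h, hh⟩ := Module.Injective.out f hf (LinearMap.fst R E F ∘ₗ g)
    obtain ⟨k, hk⟩ := Module.Injective.out f hf (LinearMap.snd R E F ∘ₗ g)
    exact ⟨h.prod k, fun x => Prod.ext (by simp [hh]) (by simp [hk])⟩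

lemma exists_extension {E M N : Type u} [AddCommGroup E] [Module R E] [AddCommGroup M]
    [Module R M] [AddCommGroup N] [Module R N] [Module.Injective R E] (f : M →ₗ[R] N)
    (hf : Function.Injective f) (g : M →ₗ[R] E) : ∃ h : N →ₗ[R] E, h ∘ₗ f = g := by
  obtain ⟨h, hh⟩ := Module.Injective.out f hf g
  exact ⟨h, LinearMap.ext hh⟩

/-- Every finitely generated module embeds into a finitely generated injective module. -/
def EnoughFiniteInjectives (R : Type u) [Ring R] : Prop :=
  ∀ (M : Type u) [AddCommGroup M] [Module R M], Module.Finite R M →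
    ∃ (E : ModuleCat.{u} R) (j : M →ₗ[R] E), Function.Injective j ∧ Module.Finite R E ∧
      Module.Injective R E

/-- A finitely generated injective hull. -/
structure IsFiniteHull {M E : Type u} [AddCommGroup M] [Module R M] [AddCommGroup E] [Module R E]
    (j : M →ₗ[R] E) : Prop where
  inj : Function.Injective j
  finite : Module.Finite R E
  injective : Module.Injective R E
  essential : IsEssentialSubmodule (LinearMap.range j)

/-- Inside a finitely generated injective E take a maximal essential extension F of M, and X maximal
with F ∩ X = 0. Then F → E/X is essential, so the extension q : E/X → E of the inclusion of F is
injective. Its range is again essential over M, hence equals F by maximality. So F is a retract of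
E, and therefore injective. -/
lemma exists_isFiniteHull [IsNoetherianRing R] (hR : EnoughFiniteInjectives R) (M : Type u)
    [AddCommGroup M] [Module R M] [hM : Module.Finite R M] :
    ∃ (E : ModuleCat.{u} R) (j : M →ₗ[R] E), IsFiniteHull j := by
  obtain ⟨E, j, hj, hEf, hEi⟩ := hR M hM
  have hmax := set_has_maximal_iff_noetherian.2 (isNoetherian_of_isNoetherianRing_of_finite R E)
  obtain ⟨F, ⟨hjF, hF⟩, hFmax⟩ := hmax {F : Submodule R E | LinearMap.range j ≤ F ∧
    ∀ L ≤ F, LinearMap.range j ⊓ L = ⊥ → L = ⊥}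
    ⟨LinearMap.range j, le_rfl, fun L hL h => by rwa [inf_eq_right.2 hL] at h⟩
  obtain ⟨X, hX, hXmax⟩ := hmax {X : Submodule R E | F ⊓ X = ⊥} ⟨⊥, by simp⟩
  have hFX : ∀ x ∈ F, X.mkQ x = 0 → x = 0 := fun x hx h =>
    (Submodule.mem_bot R).1 (hX ▸ ⟨hx, by simpa using h⟩)
  have hpF : Function.Injective (X.mkQ ∘ₗ F.subtype) := by
    rw [← LinearMap.ker_eq_bot, LinearMap.ker_eq_bot']
    exact fun x hx => Subtype.ext (hFX x x.2 hx)
  obtain ⟨q, hq⟩ := exists_extension (X.mkQ ∘ₗ F.subtype) hpF F.subtype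
  have hq' : ∀ x ∈ F, q (X.mkQ x) = x := fun x hx => LinearMap.congr_fun hq ⟨x, hx⟩
  have hess : ∀ L : Submodule R (E ⧸ X), (∀ x ∈ F, X.mkQ x ∈ L → x = 0) → L = ⊥ := by
    intro L hL
    have h1 : L.comap X.mkQ = X := by
      by_contra hne
      refine hXmax (L.comap X.mkQ) ?_ (lt_of_le_of_ne ?_ (Ne.symm hne))
      · exact (Submodule.eq_bot_iff _).2 fun x hx => hL x hx.1 hx.2
      · intro x hx
        have : X.mkQ x = 0 := by simpa using hx
        simp [Submodule.mem_comap, this]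
    rw [← Submodule.map_comap_eq_of_surjective X.mkQ_surjective L, h1, Submodule.mkQ_map_self]
  have hqinj : LinearMap.ker q = ⊥ := hess _ fun x hx h => by rw [← hq' x hx]; exact h
  have hle : F ≤ LinearMap.range q := fun x hx => ⟨X.mkQ x, hq' x hx⟩
  have hFq : F = LinearMap.range q := by
    by_contra hne
    refine hFmax (LinearMap.range q) ⟨hjF.trans hle, fun L hL h => ?_⟩ (lt_of_le_of_ne hle hne)
    have h1 : L.comap q = ⊥ := hess _ fun x hx hxL => by
      have h2 : L ⊓ F = ⊥ := hF _ inf_le_right (by rw [← inf_assoc, h, bot_inf_eq])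
      have h3 : x ∈ L ⊓ F := ⟨(hq' x hx) ▸ (show q (X.mkQ x) ∈ L from hxL), hx⟩
      rwa [h2, Submodule.mem_bot] at h3
    rw [← Submodule.map_comap_eq_self hL, h1, Submodule.map_bot]
  let r : E →ₗ[R] F := (q ∘ₗ X.mkQ).codRestrict F fun x => hFq ▸ ⟨_, rfl⟩
  have hr : r ∘ₗ F.subtype = LinearMap.id := by
    ext x
    exact hq' x x.2
  refine ⟨ModuleCat.of R F, j.codRestrict F fun x => hjF ⟨x, rfl⟩, ?_, ?_, ?_, ?_⟩
  · exact fun x y h => hj (congrArg Subtype.val h)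
  · have := isNoetherian_of_isNoetherianRing_of_finite R E
    exact inferInstanceAs (Module.Finite R F)
  · exact injective_of_retract F.subtype r hr
  · intro L hL
    have : L.map F.subtype = ⊥ := by
      refine hF _ (Submodule.map_subtype_le F L) ((Submodule.eq_bot_iff _).2 ?_)
      rintro _ ⟨⟨m, rfl⟩, ⟨y, hy, hym⟩⟩
      have h1 : y ∈ (LinearMap.range (j.codRestrict F fun x => hjF ⟨x, rfl⟩)) ⊓ L :=
        ⟨⟨m, Subtype.ext hym.symm⟩, hy⟩
      rw [hL, Submodule.mem_bot] at h1
      rw [← hym, h1]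
      rfl
    exact Submodule.map_injective_of_injective F.injective_subtype
      (this.trans (Submodule.map_bot _).symm)

/-- Let L be a minimal submodule of a finite free module that still maps onto M. Lifting the cover p
through L gives g, whose restriction to L is onto by minimality, hence bijective because L is
Noetherian. So L is a direct summand, and minimality makes the kernel superfluous. -/
lemma exists_projectiveCover [IsNoetherianRing R] [IsArtinianRing R] (M : Type u) [AddCommGroup M]
    [Module R M] [Module.Finite R M] : ∃ (P : ModuleCat.{u} R) (π : P →ₗ[R] M),
      Module.Finite R P ∧ Module.Projective R P ∧ Function.Surjective π ∧
        IsSuperfluousSubmodule (LinearMap.ker π) := by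
  obtain ⟨n, p, hp⟩ := Module.Finite.exists_fin' R M
  obtain ⟨L, hL, hLmin⟩ := IsArtinian.set_has_minimal
    {L : Submodule R (Fin n → R) | LinearMap.ker p ⊔ L = ⊤} ⟨⊤, by simp⟩
  have hsup : ∀ L : Submodule R (Fin n → R), (∀ x, ∃ y ∈ L, p y = p x) →
      LinearMap.ker p ⊔ L = ⊤ := by
    refine fun L h => eq_top_iff.2 fun x _ => ?_
    obtain ⟨y, hy, hyx⟩ := h x
    exact Submodule.mem_sup.2 ⟨x - y, by simp [hyx], y, hy, by simp⟩
  have hpL : ∀ x, ∃ y ∈ L, p y = p x := fun x => by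
    have : x ∈ LinearMap.ker p ⊔ L := hL ▸ Submodule.mem_top
    obtain ⟨k, hk, y, hy, rfl⟩ := Submodule.mem_sup.1 this
    exact ⟨y, hy, by simp [LinearMap.mem_ker.1 hk]⟩
  have hsurj : Function.Surjective (p ∘ₗ L.subtype) := fun m => by
    obtain ⟨x, rfl⟩ := hp m
    obtain ⟨y, hy, h⟩ := hpL x
    exact ⟨⟨y, hy⟩, h⟩
  obtain ⟨g, hg⟩ := Module.projective_lifting_property (p ∘ₗ L.subtype) p hsurj
  have hg' : ∀ x, p (g x) = p x := fun x => LinearMap.congr_fun hg x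
  have hrange : (LinearMap.range (g ∘ₗ L.subtype)).map L.subtype = L := by
    by_contra hne
    refine hLmin _ (hsup _ fun x => ?_) (lt_of_le_of_ne (Submodule.map_subtype_le L _) hne)
    obtain ⟨y, hy, h⟩ := hpL x
    exact ⟨g y, ⟨g y, ⟨⟨y, hy⟩, rfl⟩, rfl⟩, by rw [hg', h]⟩
  have hgs : Function.Surjective (g ∘ₗ L.subtype) := fun y => by
    obtain ⟨z, hz, hzy⟩ := hrange.symm.le y.2
    obtain rfl : z = y := Subtype.ext hzy
    exact hz
  have hgb : Function.Bijective (g ∘ₗ L.subtype) :=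
    ⟨IsNoetherian.injective_of_surjective_endomorphism _ hgs, hgs⟩
  let e := LinearEquiv.ofBijective (g ∘ₗ L.subtype) hgb
  refine ⟨ModuleCat.of R L, p ∘ₗ L.subtype, inferInstanceAs (Module.Finite R L), ?_, hsurj, ?_⟩
  · refine Module.Projective.of_split L.subtype (e.symm.toLinearMap ∘ₗ g)
      (LinearMap.ext fun x => ?_)
    exact e.symm_apply_apply x
  · intro L' hL'
    have h1 : L'.map L.subtype = L := by
      by_contra hne
      refine hLmin _ (hsup _ fun x => ?_) (lt_of_le_of_ne (Submodule.map_subtype_le L _) hne)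
      obtain ⟨y, hy, h⟩ := hpL x
      have : (⟨y, hy⟩ : L) ∈ LinearMap.ker (p ∘ₗ L.subtype) ⊔ L' := hL' ▸ Submodule.mem_top
      obtain ⟨k, hk, z, hz, hkz⟩ := Submodule.mem_sup.1 this
      refine ⟨z, ⟨z, hz, rfl⟩, ?_⟩
      have h2 : p (k : Fin n → R) = 0 := hk
      rw [← h, show y = (k : Fin n → R) + z from (congrArg Subtype.val hkz).symm, map_add, h2,
        zero_add]
    refine eq_top_iff.2 fun y _ => ?_
    obtain ⟨z, hz, hzy⟩ := h1.symm.le y.2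
    obtain rfl : z = y := Subtype.ext hzy
    exact hz

/-- A finite free cover of M lifts through g, and the image of the lift together with the
superfluous kernel is all of P. This recovers finiteness, which `MinimalPresentation` does not
demand. -/
lemma finite_of_superfluous_ker {P M : Type u} [AddCommGroup P] [Module R P] [AddCommGroup M]
    [Module R M] [Module.Finite R M] {g : P →ₗ[R] M} (hg : Function.Surjective g)
    (hs : IsSuperfluousSubmodule (LinearMap.ker g)) : Module.Finite R P := by
  obtain ⟨n, p, hp⟩ := Module.Finite.exists_fin' R M
  obtain ⟨h, hh⟩ := Module.projective_lifting_property g p hg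
  refine Module.Finite.of_surjective h
    (LinearMap.range_eq_top.1 (hs _ (eq_top_iff.2 fun x _ => ?_)))
  obtain ⟨y, hy⟩ := hp (g x)
  refine Submodule.mem_sup.2 ⟨x - h y, ?_, h y, ⟨y, rfl⟩, by simp⟩
  have : g (h y) = p y := LinearMap.congr_fun hh y
  simp [this, hy]

end Hulls

/-! ### Minimal projective presentations. -/

section Presentations

variable {A : Type u} [Ring A] {M : ModuleCat.{u} Aᵐᵒᵖ}

lemma exists_minimalPresentation [IsNoetherianRing Aᵐᵒᵖ] [IsArtinianRing Aᵐᵒᵖ]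
    (hM : Module.Finite Aᵐᵒᵖ M) : ∃ p : MinimalPresentation M,
      Module.Finite Aᵐᵒᵖ p.P₀ ∧ Module.Finite Aᵐᵒᵖ p.P₁ := by
  obtain ⟨P₀, π, h1, h2, h3, h4⟩ := exists_projectiveCover (R := Aᵐᵒᵖ) M
  have : IsNoetherian Aᵐᵒᵖ P₀ := isNoetherian_of_isNoetherianRing_of_finite _ _
  obtain ⟨P₁, f, k1, k2, k3, k4⟩ := exists_projectiveCover (R := Aᵐᵒᵖ) (LinearMap.ker π)
  refine ⟨⟨P₁, P₀, k2, h2, (LinearMap.ker π).subtype ∘ₗ f, π, h3, ?_, h4, ?_⟩, h1, k1⟩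
  · rw [LinearMap.range_comp, LinearMap.range_eq_top.2 k3, Submodule.map_top,
      Submodule.range_subtype]
  · rwa [LinearMap.ker_comp_of_ker_eq_bot _ (Submodule.ker_subtype _)]

lemma MinimalPresentation.finite₀ [Module.Finite Aᵐᵒᵖ M] (p : MinimalPresentation M) :
    Module.Finite Aᵐᵒᵖ p.P₀ :=
  finite_of_superfluous_ker p.surjective p.superfluous₀

lemma MinimalPresentation.finite₁ [IsNoetherianRing Aᵐᵒᵖ] [Module.Finite Aᵐᵒᵖ M]
    (p : MinimalPresentation M) : Module.Finite Aᵐᵒᵖ p.P₁ := by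
  have := p.finite₀
  have : IsNoetherian Aᵐᵒᵖ p.P₀ := isNoetherian_of_isNoetherianRing_of_finite _ _
  refine finite_of_superfluous_ker (g := p.f.rangeRestrict) p.f.surjective_rangeRestrict ?_
  rw [LinearMap.ker_rangeRestrict]
  exact p.superfluous₁

end Presentations

/-! ### Dominant dimension through Ext from torsion modules. -/

section DominantDimension

variable {R : Type u} [Ring R]

/-- Modules without nonzero maps to projective-injective modules. -/
def IsTorsion (R : Type u) [Ring R] (T : Type u) [AddCommGroup T] [Module R T] : Prop :=
  ∀ Q : ModuleCat.{u} R, Module.Projective R Q → Module.Injective R Q →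
    ∀ f : T →ₗ[R] Q, f = 0

/-- The homological form of `dominant dimension at least n`: the groups `Extⁱ(T, M)` vanish for
all `i < n` and all modules `T` without nonzero maps to projective-injective modules. -/
def DomGE (R : Type u) [Ring R] (n : ℕ) (M : Type u) [AddCommGroup M] [Module R M] : Prop :=
  ∀ T : ModuleCat.{u} R, IsTorsion R T → ∀ i < n, ExtVanish R T M i

variable {M P C E : Type u} [AddCommGroup M] [Module R M] [AddCommGroup P] [Module R P]
  [AddCommGroup C] [Module R C] [AddCommGroup E] [Module R E]

lemma DomGE.mono {m n : ℕ} (h : DomGE R n M) (hmn : m ≤ n) : DomGE R m M :=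
  fun T hT i hi => h T hT i (hi.trans_le hmn)

lemma domGE_of_projective_injective [Module.Projective R E] [Module.Injective R E] (n : ℕ) :
    DomGE R n E := by
  rintro T hT (_ | i) -
  · exact extVanish_zero_iff.2 (hT (ModuleCat.of R E) ‹_› ‹_›)
  · exact extVanish_of_injective i

lemma DomGE.of_finite_projective {n : ℕ} (h : DomGE R n R) [Module.Finite R P]
    [Module.Projective R P] : DomGE R n P :=
  fun T hT i hi => (h T hT i hi).of_finite_projective

lemma DomGE.of_ses {f : M →ₗ[R] P} {g : P →ₗ[R] C} (h : IsSES f g) {n : ℕ}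
    (hP : DomGE R (n + 1) P) (hC : DomGE R n C) : DomGE R (n + 1) M := by
  rintro T hT (_ | i) hi
  · exact h.covariant_zero (hP T hT 0 hi)
  · exact h.covariant₁ (hC T hT i (by lia)) (hP T hT _ hi)

lemma DomGE.quotient {f : M →ₗ[R] P} {g : P →ₗ[R] C} (h : IsSES f g) {n : ℕ}
    (hP : DomGE R n P) (hM : DomGE R (n + 1) M) : DomGE R n C :=
  fun T hT i hi => h.covariant₃ (hP T hT i hi) (hM T hT _ (by lia))

/-- Among maps from M to projective-injectives choose one with minimal kernel. Every other such map
vanishes on that kernel, which is therefore torsion. A torsion module has no nonzero map to M, so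
the kernel is zero. -/
lemma DomGE.exists_embedding [IsArtinian R M] (h : DomGE R 1 M) :
    ∃ (Q : ModuleCat.{u} R) (f : M →ₗ[R] Q), Module.Projective R Q ∧ Module.Injective R Q ∧
      Function.Injective f := by
  obtain ⟨_, ⟨Q, f, hQp, hQi, rfl⟩, hmin⟩ := IsArtinian.set_has_minimal
    {N : Submodule R M | ∃ (Q : ModuleCat.{u} R) (f : M →ₗ[R] Q), Module.Projective R Q ∧
      Module.Injective R Q ∧ LinearMap.ker f = N}
    ⟨⊤, ModuleCat.of R PUnit, 0, inferInstanceAs (Module.Projective R PUnit.{u + 1}),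
      ⟨fun _ _ _ _ _ _ _ _ _ => ⟨0, fun _ => Subsingleton.elim _ _⟩⟩, LinearMap.ker_zero⟩
  refine ⟨Q, f, hQp, hQi, LinearMap.ker_eq_bot.1 ?_⟩
  have key : ∀ (Q' : ModuleCat.{u} R) (g : M →ₗ[R] Q'), Module.Projective R Q' →
      Module.Injective R Q' → ∀ x ∈ LinearMap.ker f, g x = 0 := by
    intro Q' g hp hi x hx
    by_contra hgx
    refine hmin (LinearMap.ker (f.prod g)) ⟨ModuleCat.of R (Q × Q'), f.prod g,
      inferInstanceAs (Module.Projective R (Q × Q')), injective_prod, rfl⟩ ?_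
    rw [LinearMap.ker_prod]
    refine lt_of_le_of_ne inf_le_left fun heq => hgx ?_
    rw [← heq] at hx
    exact hx.2
  have hT : IsTorsion R (LinearMap.ker f) := by
    intro Q' hp hi φ
    obtain ⟨ψ, hψ⟩ := exists_extension (LinearMap.ker f).subtype
      (Submodule.injective_subtype _) φ
    ext x
    rw [← hψ]
    exact key Q' ψ hp hi x x.2
  have h0 := extVanish_zero_iff.1 (h (ModuleCat.of R (LinearMap.ker f)) hT 0 one_pos)
    (LinearMap.ker f).subtype
  rw [← Submodule.range_subtype (LinearMap.ker f), h0, LinearMap.range_zero]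

/-- An embedding of M into a projective-injective Q extends to the hull. The extension is injective
by essentiality and splits because the hull is injective. -/
lemma IsFiniteHull.projective [IsArtinian R M] {j : M →ₗ[R] E} (hj : IsFiniteHull j)
    (h : DomGE R 1 M) : Module.Projective R E := by
  obtain ⟨Q, f, hQp, hQi, hf⟩ := h.exists_embedding
  obtain ⟨g, hg⟩ := exists_extension j hj.inj f
  have hg' : ∀ x, g (j x) = f x := LinearMap.congr_fun hg
  have hginj : LinearMap.ker g = ⊥ := by
    refine hj.essential _ ((Submodule.eq_bot_iff _).2 ?_)
    rintro _ ⟨⟨m, rfl⟩, hm⟩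
    have : f m = 0 := (hg' m).symm.trans hm
    rw [hf (this.trans (map_zero f).symm), map_zero]
  have := hj.injective
  obtain ⟨r, hr⟩ := exists_extension g (LinearMap.ker_eq_bot.1 hginj) LinearMap.id
  exact Module.Projective.of_split g r hr

lemma le_domdim_iff {M : ModuleCat.{u} R} {n : ℕ} : (n : ℕ∞) ≤ domdim M ↔ n = 0 ∨
    ∃ I : InjectiveResolution M, IsMinimalResolution I ∧
      ∀ i < n, Module.Projective R (I.cocomplex.X i) := by
  constructor
  · intro h
    rcases Nat.eq_zero_or_pos n with rfl | hn
    · exact .inl rfl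
    refine .inr ?_
    -- A supremum need not be attained, but some member exceeds n - 1, and that suffices for
    -- integers.
    have hlt : ((n - 1 : ℕ) : ℕ∞) < domdim M :=
      lt_of_lt_of_le (by exact_mod_cast Nat.sub_lt hn one_pos) h
    obtain ⟨_, ⟨k, rfl, I, hI, hk⟩, hlt⟩ := lt_sSup_iff.1 hlt
    have : n - 1 < k := by exact_mod_cast hlt
    exact ⟨I, hI, fun i hi => hk i (by lia)⟩
  · rintro (rfl | ⟨I, hI, h⟩)
    · simp
    · exact le_sSup ⟨n, rfl, I, hI, h⟩

lemma domGE_of_le_domdim {M : ModuleCat.{u} R} {n : ℕ} (h : (n : ℕ∞) ≤ domdim M) :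
    DomGE R n M := by
  rcases le_domdim_iff.1 h with rfl | ⟨I, -, hI⟩
  · exact fun T _ i hi => absurd hi (Nat.not_lt_zero i)
  intro T hT i hi
  have hinj : Module.Injective R (I.cocomplex.X i) :=
    have := I.injective i
    Module.injective_module_of_injective_object R _
  have hzero : ∀ α : Ext T M i, α = 0 := by
    intro α
    -- A class in degree i is represented by a map from T to the projective-injective module Iᵢ,
    -- which is zero as T is torsion.
    obtain ⟨f, hf, rfl⟩ := I.extMk_surjective α (i + 1) rfl
    have : f = 0 := by
      ext1
      exact hT _ (hI i hi) hinj f.hom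
    subst this
    exact I.extMk_zero _ _
  exact ⟨fun a b => (hzero a).trans (hzero b).symm⟩

end DominantDimension

/-! ### Injective resolutions from exact sequences of injectives. -/

section ResolutionOfExact

variable {R : Type u} [Ring R] {M : ModuleCat.{u} R} {X : ℕ → ModuleCat.{u} R}
  (d : ∀ n, X n →ₗ[R] X (n + 1)) (hd : ∀ n, Function.Exact (d n) (d (n + 1)))

/-- The cochain complex attached to an exact sequence of modules. -/
noncomputable def complexOfExact : CochainComplex (ModuleCat.{u} R) ℕ :=
  CochainComplex.of X (fun n => ModuleCat.ofHom (d n)) fun n => by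
    ext1
    exact (hd n).linearMap_comp_eq_zero

lemma complexOfExact_d (n : ℕ) : (complexOfExact d hd).d n (n + 1) = ModuleCat.ofHom (d n) := by
  simp [complexOfExact]

/-- The injective resolution attached to an exact sequence of injective modules. -/
noncomputable def resolutionOfExact (hX : ∀ n, Module.Injective R (X n)) (j : M →ₗ[R] X 0)
    (hj : Function.Injective j) (hj0 : Function.Exact j (d 0)) : InjectiveResolution M where
  cocomplex := complexOfExact d hd
  injective n := by
    have := hX n
    exact Module.injective_object_of_injective_module R (X n)
  ι := (CochainComplex.fromSingle₀Equiv _ _).symm ⟨ModuleCat.ofHom j, by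
    rw [complexOfExact_d]
    ext1
    exact hj0.linearMap_comp_eq_zero⟩
  quasiIso := ⟨fun n => by
    cases n with
    | zero =>
      -- In degree 0 the quasi-isomorphism condition is exactness of 0 → M → X₀ → X₁; in positive
      -- degrees the source is zero, and exactness of the sequence is all that is needed.
      rw [CochainComplex.quasiIsoAt₀_iff, ShortComplex.quasiIso_iff_of_zeros]
      · refine (ShortComplex.exact_and_mono_f_iff_of_iso (S₂ := ShortComplex.mk (ModuleCat.ofHom j)
          ((complexOfExact d hd).d 0 1) ?_) ?_).2 ⟨?_, ?_⟩
        · rw [complexOfExact_d]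
          ext1
          exact hj0.linearMap_comp_eq_zero
        · exact ShortComplex.isoMk (Iso.refl _) (Iso.refl _) (Iso.refl _)
            (by
              refine (Category.id_comp _).trans (Eq.trans ?_ (Category.comp_id _).symm)
              exact (CochainComplex.fromSingle₀Equiv_symm_apply_f_zero
                (C := complexOfExact d hd) (X := M) (ModuleCat.ofHom j) _).symm)
            ((Category.id_comp _).trans (Category.comp_id _).symm)
        · rw [ShortComplex.ShortExact.moduleCat_exact_iff_function_exact]
          change Function.Exact j ((complexOfExact d hd).d 0 (0 + 1)).hom
          rw [complexOfExact_d]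
          exact hj0
        · exact (ModuleCat.mono_iff_injective _).2 hj
      all_goals rfl
    | succ n =>
      rw [quasiIsoAt_iff_exactAt]
      · rw [HomologicalComplex.exactAt_iff' _ n (n + 1) (n + 1 + 1) (by simp) (by simp),
          ShortComplex.ShortExact.moduleCat_exact_iff_function_exact]
        change Function.Exact ((complexOfExact d hd).d n (n + 1)).hom
          ((complexOfExact d hd).d (n + 1) (n + 1 + 1)).hom
        rw [complexOfExact_d, complexOfExact_d]
        exact hd n
      · apply CochainComplex.exactAt_succ_single_obj⟩

lemma isMinimalResolution_resolutionOfExact (hX : ∀ n, Module.Injective R (X n)) (j : M →ₗ[R] X 0)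
    (hj : Function.Injective j) (hj0 : Function.Exact j (d 0))
    (hess : ∀ n, IsEssentialSubmodule (LinearMap.ker (d n))) :
    IsMinimalResolution (resolutionOfExact d hd hX j hj hj0) := by
  intro i
  change IsEssentialSubmodule (LinearMap.ker ((complexOfExact d hd).d i (i + 1)).hom)
  rw [complexOfExact_d]
  exact hess i

end ResolutionOfExact

/-! ### The minimal injective resolution by iterated hulls. -/

section MinimalResolution

variable {R : Type u} [Ring R] [IsNoetherianRing R] (hR : EnoughFiniteInjectives R)

/-- Finitely generated modules. -/
abbrev FGMod (R : Type u) [Ring R] := {M : ModuleCat.{u} R // Module.Finite R M}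

/-- The injective hull of a finitely generated module. -/
noncomputable def hull (M : FGMod R) : ModuleCat.{u} R :=
  (have := M.2; exists_isFiniteHull hR M.1).choose

/-- The inclusion of a module into its injective hull. -/
noncomputable def hullMap (M : FGMod R) : M.1 →ₗ[R] hull hR M :=
  (have := M.2; exists_isFiniteHull hR M.1).choose_spec.choose

lemma isFiniteHull_hullMap (M : FGMod R) : IsFiniteHull (hullMap hR M) :=
  (have := M.2; exists_isFiniteHull hR M.1).choose_spec.choose_spec

/-- The cokernel of the inclusion of a module into its injective hull. -/
noncomputable def cosyzygy (M : FGMod R) : FGMod R :=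
  ⟨ModuleCat.of R (hull hR M ⧸ LinearMap.range (hullMap hR M)),
    have := (isFiniteHull_hullMap hR M).finite
    inferInstanceAs (Module.Finite R (hull hR M ⧸ LinearMap.range (hullMap hR M)))⟩

/-- Iterated cosyzygies. -/
noncomputable def cosyzygies (M : FGMod R) : ℕ → FGMod R
  | 0 => M
  | n + 1 => cosyzygy hR (cosyzygies M n)

/-- The projection from the hull of a module onto its cosyzygy. -/
noncomputable def hullProj (M : FGMod R) : hull hR M →ₗ[R] (cosyzygy hR M).1 :=
  (LinearMap.range (hullMap hR M)).mkQ

lemma isSES_hull (M : FGMod R) : IsSES (hullMap hR M) (hullProj hR M) :=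
  IsSES.mkQ (isFiniteHull_hullMap hR M).inj

/-- The differentials of the minimal injective resolution. -/
noncomputable def minimalD (M : FGMod R) :
    hull hR M →ₗ[R] hull hR (cosyzygy hR M) :=
  hullMap hR (cosyzygy hR M) ∘ₗ hullProj hR M

lemma ker_minimalD (M : FGMod R) :
    LinearMap.ker (minimalD hR M) = LinearMap.range (hullMap hR M) := by
  rw [minimalD, LinearMap.ker_comp_of_ker_eq_bot _
    (LinearMap.ker_eq_bot.2 (isSES_hull hR (cosyzygy hR M)).inj)]
  exact LinearMap.exact_iff.1 (isSES_hull hR M).exact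

lemma range_minimalD (M : FGMod R) : LinearMap.range (minimalD hR M) =
    LinearMap.range (hullMap hR (cosyzygy hR M)) := by
  rw [minimalD, LinearMap.range_comp, LinearMap.range_eq_top.2 (isSES_hull hR M).surj,
    Submodule.map_top]

lemma essential_ker_minimalD (M : FGMod R) :
    IsEssentialSubmodule (LinearMap.ker (minimalD hR M)) := by
  rw [ker_minimalD]
  exact (isFiniteHull_hullMap hR M).essential

lemma hullMap_exact (M : FGMod R) : Function.Exact (hullMap hR M) (minimalD hR M) :=
  LinearMap.exact_iff.2 (ker_minimalD hR M)

lemma minimalD_exact (M : FGMod R) :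
    Function.Exact (minimalD hR M) (minimalD hR (cosyzygy hR M)) :=
  LinearMap.exact_iff.2 ((ker_minimalD hR _).trans (range_minimalD hR M).symm)

lemma DomGE.hull [IsArtinianRing R] {M : FGMod R} {n : ℕ} (h : DomGE R (n + 1) M.1) :
    Module.Projective R (hull hR M) ∧ DomGE R n (cosyzygy hR M).1 := by
  have := M.2
  have hj := isFiniteHull_hullMap hR M
  have hi := hj.injective
  have hp := hj.projective (h.mono (by lia))
  exact ⟨hp, .quotient (isSES_hull hR M) (domGE_of_projective_injective n) h⟩

include hR in
lemma le_domdim_of_domGE [IsArtinianRing R] {M : ModuleCat.{u} R} (hM : Module.Finite R M) {n : ℕ}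
    (h : DomGE R n M) : (n : ℕ∞) ≤ domdim M := by
  let N := cosyzygies hR ⟨M, hM⟩
  have key : ∀ i < n, DomGE R (n - i) (N i).1 := by
    intro i hi
    induction i with
    | zero => exact h
    | succ i ih =>
      refine (DomGE.hull hR ?_).2
      rw [show n - (i + 1) + 1 = n - i by lia]
      exact ih (by lia)
  have hN (i : ℕ) := isFiniteHull_hullMap hR (N i)
  exact le_domdim_iff.2 (.inr ⟨resolutionOfExact (M := M) (X := fun i => GorDom.hull hR (N i))
    (fun i => minimalD hR (N i)) (fun i => minimalD_exact hR (N i)) (fun i => (hN i).injective)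
    (hullMap hR (N 0)) (hN 0).inj (hullMap_exact hR (N 0)),
    isMinimalResolution_resolutionOfExact _ _ _ _ _ _ fun i => essential_ker_minimalD hR (N i),
    fun i hi => (DomGE.hull hR ((key i hi).mono (by lia : 0 + 1 ≤ n - i))).1⟩)

end MinimalResolution

open MulOpposite

/-! ### Duals of projectives, the transpose, and cosyzygies of Gorenstein projectives. -/

section Transpose

variable {A : Type u} [Ring A]

/-- The two descriptions of the regular right module. -/
def unopLinearEquiv (A : Type u) [Ring A] : Aᵐᵒᵖ ≃ₗ[Aᵐᵒᵖ] A where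
  toFun := unop
  invFun := op
  left_inv _ := rfl
  right_inv _ := rfl
  map_add' _ _ := rfl
  map_smul' _ _ := rfl

instance finite_rightRegular : Module.Finite Aᵐᵒᵖ A :=
  Module.Finite.equiv (unopLinearEquiv A)

instance projective_rightRegular : Module.Projective Aᵐᵒᵖ A :=
  Module.Projective.of_equiv (unopLinearEquiv A)

instance projective_pi_rightRegular (n : ℕ) : Module.Projective Aᵐᵒᵖ (Fin n → A) :=
  Module.Projective.of_equiv (LinearEquiv.piCongrRight fun _ : Fin n => unopLinearEquiv A)

lemma exists_factor {R M N L : Type*} [Ring R] [AddCommGroup M] [Module R M] [AddCommGroup N]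
    [Module R N] [AddCommGroup L] [Module R L] {π : M →ₗ[R] N} (hπ : Function.Surjective π)
    (φ : M →ₗ[R] L) (h : LinearMap.ker π ≤ LinearMap.ker φ) : ∃ j : N →ₗ[R] L, j ∘ₗ π = φ := by
  refine ⟨(LinearMap.ker π).liftQ φ h ∘ₗ (π.quotKerEquivOfSurjective hπ).symm.toLinearMap, ?_⟩
  ext x
  have : (π.quotKerEquivOfSurjective hπ).symm (π x) = (LinearMap.ker π).mkQ x := by
    rw [LinearEquiv.symm_apply_eq]
    rfl
  simp [this]

variable {P P₀ P₁ P₂ M : Type u} [AddCommGroup P] [Module Aᵐᵒᵖ P] [AddCommGroup P₀]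
  [Module Aᵐᵒᵖ P₀] [AddCommGroup P₁] [Module Aᵐᵒᵖ P₁] [AddCommGroup P₂] [Module Aᵐᵒᵖ P₂]
  [AddCommGroup M] [Module Aᵐᵒᵖ M]

lemma exists_dualBasis (A : Type u) [Ring A] (P : Type u) [AddCommGroup P] [Module Aᵐᵒᵖ P]
    [Module.Finite Aᵐᵒᵖ P] [Module.Projective Aᵐᵒᵖ P] :
    ∃ (n : ℕ) (p : Fin n → P) (s : Fin n → (P →ₗ[Aᵐᵒᵖ] A)),
      ∀ x, ∑ i, op (s i x) • p i = x := by
  obtain ⟨n, s, r, hrs⟩ := exists_retract_of_finite_projective Aᵐᵒᵖ P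
  refine ⟨n, fun i => r (Pi.single i 1),
    fun i => (unopLinearEquiv A).toLinearMap ∘ₗ LinearMap.proj i ∘ₗ s, fun x => ?_⟩
  have h : r (s x) = x := LinearMap.congr_fun hrs x
  conv_rhs => rw [← h, ← (Pi.basisFun Aᵐᵒᵖ (Fin n)).sum_repr (s x), map_sum]
  simp [unopLinearEquiv]

lemma dualBasis_dual {n : ℕ} {p : Fin n → P} {s : Fin n → (P →ₗ[Aᵐᵒᵖ] A)}
    (h : ∀ x, ∑ i, op (s i x) • p i = x) (ψ : P →ₗ[Aᵐᵒᵖ] A) : ∑ i, ψ (p i) • s i = ψ := by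
  ext x
  conv_rhs => rw [← h x, map_sum]
  simp

instance finite_dual [Module.Finite Aᵐᵒᵖ P] [Module.Projective Aᵐᵒᵖ P] :
    Module.Finite A (P →ₗ[Aᵐᵒᵖ] A) := by
  obtain ⟨n, p, s, h⟩ := exists_dualBasis A P
  refine Module.Finite.of_surjective (Fintype.linearCombination A s) fun ψ =>
    ⟨fun i => ψ (p i), ?_⟩
  rw [Fintype.linearCombination_apply, dualBasis_dual h]

instance projective_dual [Module.Finite Aᵐᵒᵖ P] [Module.Projective Aᵐᵒᵖ P] :
    Module.Projective A (P →ₗ[Aᵐᵒᵖ] A) := by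
  obtain ⟨n, p, s, h⟩ := exists_dualBasis A P
  let i : (P →ₗ[Aᵐᵒᵖ] A) →ₗ[A] (Fin n → A) :=
    { toFun := fun ψ i => ψ (p i)
      map_add' := fun _ _ => rfl
      map_smul' := fun _ _ => rfl }
  refine Module.Projective.of_split i (Fintype.linearCombination A s) (LinearMap.ext fun ψ => ?_)
  simpa [Fintype.linearCombination_apply, i] using dualBasis_dual h ψ

/-- Together with `eq_of_forall_dual_eq` this is the reflexivity of finitely generated projectives.
-/
lemma exists_eq_eval [Module.Finite Aᵐᵒᵖ P] [Module.Projective Aᵐᵒᵖ P]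
    (θ : (P →ₗ[Aᵐᵒᵖ] A) →ₗ[A] A) : ∃ y : P, ∀ ψ, θ ψ = ψ y := by
  obtain ⟨n, p, s, h⟩ := exists_dualBasis A P
  refine ⟨∑ i, op (θ (s i)) • p i, fun ψ => ?_⟩
  conv_lhs => rw [← dualBasis_dual h ψ]
  simp

lemma eq_of_forall_dual_eq [Module.Finite Aᵐᵒᵖ P] [Module.Projective Aᵐᵒᵖ P] {x y : P}
    (hxy : ∀ ψ : P →ₗ[Aᵐᵒᵖ] A, ψ x = ψ y) : x = y := by
  obtain ⟨n, p, s, h⟩ := exists_dualBasis A P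
  rw [← h x, ← h y]
  simp [hxy]

/-- The cokernel of `Hom_A(f, A)`. -/
abbrev Tr (f : P₁ →ₗ[Aᵐᵒᵖ] P₀) : Type u :=
  (P₁ →ₗ[Aᵐᵒᵖ] A) ⧸ LinearMap.range (LinearMap.lcomp A A f)

/-- `Extⁱ(Tr, A) = 0` for all `i ≥ 1`, where `Tr` is the cokernel of `Hom_A(f, A)`. -/
def TrVanish (f : P₁ →ₗ[Aᵐᵒᵖ] P₀) : Prop := ∀ i, 1 ≤ i → ExtVanish A (Tr f) A i

/-- Exactness of P₀* → P₁* → P₂* in the middle identifies Tr f with the image of P₁* in P₂*, whose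
cokernel is Tr f₂. This sequence moves Ext of the transpose by one degree. -/
lemma isSES_Tr {f : P₁ →ₗ[Aᵐᵒᵖ] P₀} {f₂ : P₂ →ₗ[Aᵐᵒᵖ] P₁}
    (h : LinearMap.ker (LinearMap.lcomp A A f₂) = LinearMap.range (LinearMap.lcomp A A f)) :
    IsSES ((LinearMap.range (LinearMap.lcomp A A f)).liftQ (LinearMap.lcomp A A f₂) h.ge)
      (LinearMap.range (LinearMap.lcomp A A f₂)).mkQ :=
  .of_range_eq_ker (LinearMap.ker_eq_bot.1 (Submodule.ker_liftQ_eq_bot _ _ _ h.le))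
    (Submodule.mkQ_surjective _) (by rw [Submodule.range_liftQ, Submodule.ker_mkQ])

/-- The components of φ generate the A-module of all maps P₀ → A that kill the range of f. This
gives the factorisation property, and the sequence 0 → Tr φ → P₁* → Tr f → 0 makes `TrVanish` pass
to φ. -/
lemma TrVanish.exists_left_approximation [IsNoetherianRing A] [Module.Finite Aᵐᵒᵖ P₀]
    [Module.Projective Aᵐᵒᵖ P₀] [Module.Finite Aᵐᵒᵖ P₁] [Module.Projective Aᵐᵒᵖ P₁]
    {f : P₁ →ₗ[Aᵐᵒᵖ] P₀} (hf : TrVanish f) : ∃ (n : ℕ) (φ : P₀ →ₗ[Aᵐᵒᵖ] (Fin n → A)),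
      LinearMap.ker φ = LinearMap.range f ∧ TrVanish φ ∧
        ∀ h : P₀ →ₗ[Aᵐᵒᵖ] A, h ∘ₗ f = 0 → ∃ l : (Fin n → A) →ₗ[Aᵐᵒᵖ] A, l ∘ₗ φ = h := by
  have : IsNoetherian A (P₀ →ₗ[Aᵐᵒᵖ] A) := isNoetherian_of_isNoetherianRing_of_finite _ _
  obtain ⟨n, φ, hφ⟩ := Submodule.fg_iff_exists_fin_generating_family.1
    (IsNoetherian.noetherian (LinearMap.ker (LinearMap.lcomp A A f)))
  have hφf (i : Fin n) : φ i ∘ₗ f = 0 :=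
    (hφ ▸ Submodule.subset_span ⟨i, rfl⟩ : φ i ∈ LinearMap.ker (LinearMap.lcomp A A f))
  have hpi : LinearMap.pi φ ∘ₗ f = 0 := by
    ext x i
    exact LinearMap.congr_fun (hφf i) x
  have hK : LinearMap.ker (LinearMap.lcomp A A f) =
      LinearMap.range (LinearMap.lcomp A A (LinearMap.pi φ)) := by
    apply le_antisymm
    · rw [← hφ, Submodule.span_le]
      rintro _ ⟨i, rfl⟩
      exact ⟨LinearMap.proj i, LinearMap.proj_pi _ _⟩
    · rintro _ ⟨l, rfl⟩
      change (l ∘ₗ LinearMap.pi φ) ∘ₗ f = 0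
      rw [LinearMap.comp_assoc, hpi, LinearMap.comp_zero]
  have hses := isSES_Tr hK
  refine ⟨n, LinearMap.pi φ, le_antisymm (fun x hx => ?_) ?_, fun i hi => ?_, fun h hh => ?_⟩
  · have hxφ : ∀ ψ : P₀ →ₗ[Aᵐᵒᵖ] A, ψ ∘ₗ f = 0 → ψ x = 0 := by
      intro ψ hψ
      obtain ⟨l, hl⟩ : ψ ∈ LinearMap.range (LinearMap.lcomp A A (LinearMap.pi φ)) := hK ▸ hψ
      rw [← hl]
      change l (LinearMap.pi φ x) = 0
      rw [LinearMap.mem_ker.1 hx, map_zero]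
    let ev : (P₀ →ₗ[Aᵐᵒᵖ] A) →ₗ[A] A :=
      { toFun := fun ψ => ψ x
        map_add' := fun _ _ => rfl
        map_smul' := fun _ _ => rfl }
    -- Evaluation at x descends to Tr φ, extends to P₁* because Ext¹(Tr f, A) = 0, and is there
    -- evaluation at some y by reflexivity. Then f y = x.
    obtain ⟨θ, hθ⟩ := hses.extend_of_extVanish (hf 1 le_rfl) (Submodule.liftQ _ ev (by
      rw [← hK]
      exact hxφ))
    obtain ⟨y, hy⟩ := exists_eq_eval θ
    refine ⟨y, eq_of_forall_dual_eq (A := A) fun ψ => ?_⟩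
    have := LinearMap.congr_fun hθ (Submodule.Quotient.mk ψ)
    exact (hy (ψ ∘ₗ f)).symm.trans this
  · rintro _ ⟨x, rfl⟩
    exact LinearMap.congr_fun hpi x
  · exact hses.contravariant₁ (extVanish_of_pos_of_projective hi) (hf (i + 1) (by lia))
  · obtain ⟨l, hl⟩ : h ∈ LinearMap.range (LinearMap.lcomp A A (LinearMap.pi φ)) := hK ▸ hh
    exact ⟨l, hl⟩

/-- Ext¹(M, A) = 0 says that maps from the range of f to A extend to P₀, which is the exactness that
`isSES_Tr` requires. -/
lemma extVanish_Tr_of_syzygy [Module.Finite Aᵐᵒᵖ P₂] [Module.Projective Aᵐᵒᵖ P₂]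
    {f₂ : P₂ →ₗ[Aᵐᵒᵖ] P₁} {f : P₁ →ₗ[Aᵐᵒᵖ] P₀} {π : P₀ →ₗ[Aᵐᵒᵖ] M}
    (h₂ : LinearMap.range f₂ = LinearMap.ker f) (h₁ : LinearMap.range f = LinearMap.ker π)
    (hπ : Function.Surjective π) (hM : ExtVanish Aᵐᵒᵖ M A 1) {i : ℕ} (hi : 1 ≤ i)
    (h : ExtVanish A (Tr f₂) A (i + 1)) : ExtVanish A (Tr f) A i := by
  have hK : LinearMap.ker (LinearMap.lcomp A A f₂) = LinearMap.range (LinearMap.lcomp A A f) := by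
    apply le_antisymm
    · intro ψ hψ
      obtain ⟨χ, hχ⟩ := exists_factor f.surjective_rangeRestrict ψ (by
        rw [LinearMap.ker_rangeRestrict, ← h₂]
        rintro _ ⟨x, rfl⟩
        exact LinearMap.congr_fun (show ψ ∘ₗ f₂ = 0 from hψ) x)
      have hses : IsSES (LinearMap.range f).subtype π :=
        .of_range_eq_ker (Submodule.injective_subtype _) hπ (by rw [Submodule.range_subtype, h₁])
      obtain ⟨l, hl⟩ := hses.extend_of_extVanish hM χ
      refine ⟨l, ?_⟩
      rw [← hχ, ← hl]
      rfl
    · rintro _ ⟨l, rfl⟩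
      change (l ∘ₗ f) ∘ₗ f₂ = 0
      rw [LinearMap.comp_assoc, LinearMap.range_le_ker_iff.1 h₂.le, LinearMap.comp_zero]
  exact (isSES_Tr hK).contravariant₁ (extVanish_of_pos_of_projective hi) h

/-- Gorenstein projectivity, with an arbitrary finitely generated projective presentation in the
place of the minimal one. -/
structure IsGProj (A : Type u) [Ring A] (M : Type u) [AddCommGroup M] [Module Aᵐᵒᵖ M] : Prop where
  ext_eq_zero : ∀ i, 1 ≤ i → ExtVanish Aᵐᵒᵖ M A i
  exists_presentation : ∃ (P₁ P₀ : ModuleCat.{u} Aᵐᵒᵖ) (f : P₁ →ₗ[Aᵐᵒᵖ] P₀) (π : P₀ →ₗ[Aᵐᵒᵖ] M),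
    Module.Finite Aᵐᵒᵖ P₁ ∧ Module.Projective Aᵐᵒᵖ P₁ ∧ Module.Finite Aᵐᵒᵖ P₀ ∧
      Module.Projective Aᵐᵒᵖ P₀ ∧ Function.Surjective π ∧ LinearMap.range f = LinearMap.ker π ∧
        TrVanish f

lemma isGProj_of_mem_Gp [IsNoetherianRing Aᵐᵒᵖ] {M : ModuleCat.{u} Aᵐᵒᵖ} (h : Gp A M) :
    IsGProj A M := by
  obtain ⟨hM, h1, p, hp⟩ := h
  exact ⟨h1, p.P₁, p.P₀, p.f, p.π, p.finite₁, p.projective₁, p.finite₀, p.projective₀,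
    p.surjective, p.exact, hp⟩

/-- The left approximation φ of P₀ factors through an embedding of M, and φ itself presents the
cokernel C. Its factorisation property gives Ext¹(C, A) = 0; higher degrees follow by shifting. -/
lemma IsGProj.exists_cosyzygy [IsNoetherianRing A] (hM : IsGProj A M) :
    ∃ (n : ℕ) (C : ModuleCat.{u} Aᵐᵒᵖ) (j : M →ₗ[Aᵐᵒᵖ] (Fin n → A))
      (q : (Fin n → A) →ₗ[Aᵐᵒᵖ] C), IsSES j q ∧ IsGProj A C := by
  obtain ⟨P₁, P₀, f, π, _, _, _, _, hπ, hf, hTr⟩ := hM.exists_presentation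
  obtain ⟨n, φ, hφ, hTr', hl⟩ := hTr.exists_left_approximation
  obtain ⟨j, hj⟩ := exists_factor hπ φ (by rw [hφ, hf])
  have hjπ (x : P₀) : j (π x) = φ x := LinearMap.congr_fun hj x
  have hrange : LinearMap.range j = LinearMap.range φ := by
    rw [← hj, LinearMap.range_comp, LinearMap.range_eq_top.2 hπ, Submodule.map_top]
  have hjinj : Function.Injective j := by
    rw [← LinearMap.ker_eq_bot, LinearMap.ker_eq_bot']
    intro m hm
    obtain ⟨x, rfl⟩ := hπ m
    have : x ∈ LinearMap.ker φ := by rw [LinearMap.mem_ker, ← hjπ, hm]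
    rw [hφ, hf] at this
    exact this
  have hses := IsSES.mkQ hjinj
  refine ⟨n, ModuleCat.of Aᵐᵒᵖ ((Fin n → A) ⧸ LinearMap.range j), j, _, hses, ⟨?_, P₀,
    ModuleCat.of Aᵐᵒᵖ (Fin n → A), φ, (LinearMap.range j).mkQ, inferInstance, inferInstance,
    inferInstanceAs (Module.Finite Aᵐᵒᵖ (Fin n → A)),
    inferInstanceAs (Module.Projective Aᵐᵒᵖ (Fin n → A)), Submodule.mkQ_surjective _, ?_, hTr'⟩⟩
  · rintro (_ | _ | i) hi
    · lia
    · refine hses.extVanish_of_extend (extVanish_of_projective 0) fun h => ?_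
      obtain ⟨l, hl⟩ := hl (h ∘ₗ π) (by
        rw [LinearMap.comp_assoc, LinearMap.range_le_ker_iff.1 hf.le, LinearMap.comp_zero])
      refine ⟨l, LinearMap.ext fun m => ?_⟩
      obtain ⟨x, rfl⟩ := hπ m
      rw [LinearMap.comp_apply, hjπ]
      exact LinearMap.congr_fun hl x
    · exact hses.contravariant₃ (hM.ext_eq_zero (i + 1) (by lia)) (extVanish_of_projective _)
  · rw [Submodule.ker_mkQ, hrange]

end Transpose

/-! ### The K-duality between left and right modules. -/

section Duality

variable {K A : Type u} [Field K] [Ring A] [Algebra K A]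

variable {N N' X X' : Type u} [AddCommGroup N] [Module K N] [Module A N] [IsScalarTower K A N]
  [AddCommGroup N'] [Module K N'] [Module A N'] [IsScalarTower K A N']
  [AddCommGroup X] [Module K X] [Module Aᵐᵒᵖ X] [IsScalarTower K Aᵐᵒᵖ X]
  [AddCommGroup X'] [Module K X'] [Module Aᵐᵒᵖ X'] [IsScalarTower K Aᵐᵒᵖ X']

/-- The right module dual to a left module. -/
def LeftDual (K A N : Type u) [Field K] [Ring A] [Algebra K A] [AddCommGroup N] [Module K N]
    [Module A N] [IsScalarTower K A N] : Type u := N →ₗ[K] K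

/-- The left module dual to a right module. -/
def RightDual (K A X : Type u) [Field K] [Ring A] [Algebra K A] [AddCommGroup X] [Module K X]
    [Module Aᵐᵒᵖ X] [IsScalarTower K Aᵐᵒᵖ X] : Type u := X →ₗ[K] K

namespace LeftDual

instance : AddCommGroup (LeftDual K A N) := inferInstanceAs (AddCommGroup (N →ₗ[K] K))

instance : Module K (LeftDual K A N) := inferInstanceAs (Module K (N →ₗ[K] K))

instance : FunLike (LeftDual K A N) N K := inferInstanceAs (FunLike (N →ₗ[K] K) N K)

instance : LinearMapClass (LeftDual K A N) K N K :=
  inferInstanceAs (LinearMapClass (N →ₗ[K] K) K N K)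

instance : Module Aᵐᵒᵖ (LeftDual K A N) where
  smul b f := (f : N →ₗ[K] K) ∘ₗ Algebra.lsmul K K N b.unop
  one_smul f := LinearMap.ext fun n => congrArg f (one_smul A n)
  mul_smul b c f := LinearMap.ext fun n => congrArg f (mul_smul c.unop b.unop n)
  smul_zero _ := rfl
  smul_add _ _ _ := rfl
  add_smul b c f := LinearMap.ext fun n =>
    (congrArg f (add_smul b.unop c.unop n)).trans (map_add f _ _)
  zero_smul f := LinearMap.ext fun n => (congrArg f (zero_smul A n)).trans (map_zero f)

lemma smul_apply (b : Aᵐᵒᵖ) (f : LeftDual K A N) (n : N) : (b • f) n = f (b.unop • n) := rfl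

lemma add_apply (f g : LeftDual K A N) (n : N) : (f + g) n = f n + g n := rfl

lemma ext {f g : LeftDual K A N} (h : ∀ n, f n = g n) : f = g := LinearMap.ext h

instance : IsScalarTower K Aᵐᵒᵖ (LeftDual K A N) where
  smul_assoc k b f := LinearMap.ext fun n =>
    (congrArg f (smul_assoc k b.unop n)).trans (map_smul f k _)

/-- The dual of a linear map. -/
def map (g : N →ₗ[A] N') : LeftDual K A N' →ₗ[Aᵐᵒᵖ] LeftDual K A N where
  toFun f := (f : N' →ₗ[K] K) ∘ₗ g.restrictScalars K
  map_add' _ _ := rfl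
  map_smul' b f := LinearMap.ext fun n => congrArg f (g.map_smul b.unop n).symm

end LeftDual

namespace RightDual

instance : AddCommGroup (RightDual K A X) := inferInstanceAs (AddCommGroup (X →ₗ[K] K))

instance : Module K (RightDual K A X) := inferInstanceAs (Module K (X →ₗ[K] K))

instance : FunLike (RightDual K A X) X K := inferInstanceAs (FunLike (X →ₗ[K] K) X K)

instance : LinearMapClass (RightDual K A X) K X K :=
  inferInstanceAs (LinearMapClass (X →ₗ[K] K) K X K)

instance : Module A (RightDual K A X) where
  smul a f := (f : X →ₗ[K] K) ∘ₗ Algebra.lsmul K K X (op a)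
  one_smul f := LinearMap.ext fun x => congrArg f (one_smul Aᵐᵒᵖ x)
  mul_smul a b f := LinearMap.ext fun x => congrArg f (mul_smul (op b) (op a) x)
  smul_zero _ := rfl
  smul_add _ _ _ := rfl
  add_smul a b f := LinearMap.ext fun x =>
    (congrArg f (add_smul (op a) (op b) x)).trans (map_add f _ _)
  zero_smul f := LinearMap.ext fun x => (congrArg f (zero_smul Aᵐᵒᵖ x)).trans (map_zero f)

lemma smul_apply (a : A) (f : RightDual K A X) (x : X) : (a • f) x = f (op a • x) := rfl

lemma add_apply (f g : RightDual K A X) (x : X) : (f + g) x = f x + g x := rfl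

lemma ext {f g : RightDual K A X} (h : ∀ x, f x = g x) : f = g := LinearMap.ext h

instance : IsScalarTower K A (RightDual K A X) where
  smul_assoc k a f := LinearMap.ext fun x =>
    (congrArg f (smul_assoc k (op a) x)).trans (map_smul f k _)

/-- The dual of a linear map. -/
def map (g : X →ₗ[Aᵐᵒᵖ] X') : RightDual K A X' →ₗ[A] RightDual K A X where
  toFun f := (f : X' →ₗ[K] K) ∘ₗ g.restrictScalars K
  map_add' _ _ := rfl
  map_smul' a f := LinearMap.ext fun x => congrArg f (g.map_smul (op a) x).symm

lemma map_surjective {g : X →ₗ[Aᵐᵒᵖ] X'} (hg : Function.Injective g) :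
    Function.Surjective (map (K := K) g) := by
  intro f
  obtain ⟨r, hr⟩ := (g.restrictScalars K).exists_leftInverse_of_injective
    (LinearMap.ker_eq_bot.2 hg)
  refine ⟨(f : X →ₗ[K] K) ∘ₗ r, ext fun x => ?_⟩
  exact congrArg f (LinearMap.congr_fun hr x)

end RightDual

lemma LeftDual.map_surjective {g : N →ₗ[A] N'} (hg : Function.Injective g) :
    Function.Surjective (LeftDual.map (K := K) g) := by
  intro f
  obtain ⟨r, hr⟩ := (g.restrictScalars K).exists_leftInverse_of_injective
    (LinearMap.ker_eq_bot.2 hg)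
  refine ⟨(f : N →ₗ[K] K) ∘ₗ r, LeftDual.ext fun x => ?_⟩
  exact congrArg f (LinearMap.congr_fun hr x)

lemma isSES_leftDual_map {N'' : Type u} [AddCommGroup N''] [Module K N''] [Module A N'']
    [IsScalarTower K A N''] {f : N' →ₗ[A] N} {g : N →ₗ[A] N''} (h : IsSES f g) :
    IsSES (LeftDual.map (K := K) g) (LeftDual.map (K := K) f) where
  inj φ ψ hφψ := LeftDual.ext fun x => by
    obtain ⟨n, rfl⟩ := h.surj x
    exact DFunLike.congr_fun hφψ n
  surj := LeftDual.map_surjective h.inj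
  exact φ := by
    constructor
    · intro hφ
      obtain ⟨ψ, hψ⟩ := exists_factor (π := g.restrictScalars K) h.surj (φ : N →ₗ[K] K) (by
        intro x hx
        obtain ⟨y, rfl⟩ := (h.exact x).1 hx
        exact DFunLike.congr_fun hφ y)
      exact ⟨ψ, hψ⟩
    · rintro ⟨ψ, rfl⟩
      exact LeftDual.ext fun x => (congrArg ψ ((h.exact (f x)).2 ⟨x, rfl⟩)).trans (map_zero ψ)

/-- The adjunction between the two dualities. -/
def flipDual (φ : N →ₗ[A] RightDual K A X) : X →ₗ[Aᵐᵒᵖ] LeftDual K A N where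
  toFun x :=
    { toFun := fun n => φ n x
      map_add' := fun m n => by rw [map_add, RightDual.add_apply]
      map_smul' := fun k n => by
        rw [← algebraMap_smul A k n, map_smul, RightDual.smul_apply, RingHom.id_apply,
          ← MulOpposite.algebraMap_apply, algebraMap_smul, map_smul] }
  map_add' x y := LeftDual.ext fun n => map_add (φ n) x y
  map_smul' b x := LeftDual.ext fun n => (DFunLike.congr_fun (φ.map_smul b.unop n) x).symm

/-- The adjunction between the two dualities. -/
def unflipDual (φ : X →ₗ[Aᵐᵒᵖ] LeftDual K A N) : N →ₗ[A] RightDual K A X where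
  toFun n :=
    { toFun := fun x => φ x n
      map_add' := fun x y => by rw [map_add, LeftDual.add_apply]
      map_smul' := fun k x => by
        rw [← algebraMap_smul Aᵐᵒᵖ k x, map_smul, LeftDual.smul_apply, RingHom.id_apply,
          MulOpposite.algebraMap_apply, unop_op, algebraMap_smul, map_smul] }
  map_add' m n := RightDual.ext fun x => map_add (φ x) m n
  map_smul' a n := RightDual.ext fun x => (DFunLike.congr_fun (φ.map_smul (op a) x) n).symm

/-- The restriction of scalars of a module over an algebra. -/
@[reducible] def restrictedModule (K R M : Type u) [Field K] [Ring R] [Algebra K R]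
    [AddCommGroup M] [Module R M] : Module K M := Module.compHom M (algebraMap K R)

lemma isScalarTower_restrictedModule (K R M : Type u) [Field K] [Ring R] [Algebra K R]
    [AddCommGroup M] [Module R M] :
    letI := restrictedModule K R M
    IsScalarTower K R M :=
  letI := restrictedModule K R M
  ⟨fun k r m => by
    rw [Algebra.smul_def, mul_smul]
    rfl⟩

instance injective_leftDual [Module.Projective A N] : Module.Injective Aᵐᵒᵖ (LeftDual K A N) where
  out X Y _ _ _ _ f hf g := by
    -- The test modules carry no K-structure of their own; it is restricted from the algebra so that
    -- the adjunction applies.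
    let := restrictedModule K Aᵐᵒᵖ X
    let := restrictedModule K Aᵐᵒᵖ Y
    have := isScalarTower_restrictedModule K Aᵐᵒᵖ X
    have := isScalarTower_restrictedModule K Aᵐᵒᵖ Y
    obtain ⟨h, hh⟩ := Module.projective_lifting_property _ (unflipDual g)
      (RightDual.map_surjective (K := K) hf)
    refine ⟨flipDual h, fun x => LeftDual.ext fun n => ?_⟩
    exact DFunLike.congr_fun (LinearMap.congr_fun hh n) x

/-- A free cover of N dualises to an injective embedding of D(N). Extending along the first and
lifting along the second are the same problem under Hom(N, D X) ≅ Hom(X, D N). -/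
lemma extVanish_rightDual_iff_one : ExtVanish A N (RightDual K A X) 1 ↔
    ExtVanish Aᵐᵒᵖ X (LeftDual K A N) 1 := by
  have h := IsSES.ker (Finsupp.linearCombination_id_surjective A N)
  have h' := isSES_leftDual_map (K := K) h
  constructor
  · intro hN
    refine h'.extVanish_of_lift (extVanish_of_injective 0) fun φ => ?_
    obtain ⟨ψ, hψ⟩ := h.extend_of_extVanish hN (unflipDual φ)
    refine ⟨flipDual ψ, LinearMap.ext fun x => LeftDual.ext fun n => ?_⟩
    exact DFunLike.congr_fun (LinearMap.congr_fun hψ n) x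
  · intro hX
    refine h.extVanish_of_extend (extVanish_of_projective 0) fun φ => ?_
    obtain ⟨ψ, hψ⟩ := h'.lift_of_extVanish hX (flipDual φ)
    refine ⟨unflipDual ψ, LinearMap.ext fun n => RightDual.ext fun x => ?_⟩
    exact DFunLike.congr_fun (LinearMap.congr_fun hψ x) n

lemma extVanish_rightDual_iff {i : ℕ} (hi : 1 ≤ i) : ExtVanish A N (RightDual K A X) i ↔
    ExtVanish Aᵐᵒᵖ X (LeftDual K A N) i := by
  induction i, hi using Nat.le_induction generalizing N with
  | base => exact extVanish_rightDual_iff_one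
  | succ i hi ih =>
    have h := IsSES.ker (Finsupp.linearCombination_id_surjective A N)
    have h' := isSES_leftDual_map (K := K) h
    constructor
    · intro hN
      exact h'.covariant₁ (ih.1 (h.contravariant₁ (extVanish_of_pos_of_projective hi) hN))
        (extVanish_of_injective i)
    · intro hX
      exact h.contravariant₃ (ih.2 (h'.covariant₃ (extVanish_of_pos_of_injective hi) hX))
        (extVanish_of_projective i)

/-- A finite-dimensional left module is its own bidual. -/
noncomputable def leftBidual [FiniteDimensional K N] :
    N ≃ₗ[A] RightDual K A (LeftDual K A N) :=
  LinearEquiv.ofBijective (unflipDual LinearMap.id) (Module.evalEquiv K N).bijective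

/-- A finite-dimensional right module is its own bidual. -/
noncomputable def rightBidual [FiniteDimensional K X] :
    X ≃ₗ[Aᵐᵒᵖ] LeftDual K A (RightDual K A X) :=
  LinearEquiv.ofBijective (flipDual LinearMap.id) (Module.evalEquiv K X).bijective

/-- The map from a right module to the dual of the regular module attached to a functional. -/
def toDualRegular (l : X →ₗ[K] K) : X →ₗ[Aᵐᵒᵖ] LeftDual K A A where
  toFun x :=
    { toFun := fun a => l (op a • x)
      map_add' := fun a b => by rw [MulOpposite.op_add, add_smul, map_add]
      map_smul' := fun k a => by rw [MulOpposite.op_smul, smul_assoc, map_smul, RingHom.id_apply] }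
  map_add' x y := LeftDual.ext fun a => (congrArg l (smul_add (op a) x y)).trans (map_add l _ _)
  map_smul' b x := LeftDual.ext fun a => congrArg l (mul_smul (op a) b x).symm

/-- Each coordinate l of a K-basis of X gives x ↦ (a ↦ l(xa)). Evaluation at a = 1 recovers the
coordinates, so jointly these maps are injective. -/
lemma exists_embedding_dualRegular (K : Type u) {A X : Type u} [Field K] [Ring A] [Algebra K A]
    [FiniteDimensional K A] [AddCommGroup X] [Module Aᵐᵒᵖ X] [Module.Finite Aᵐᵒᵖ X] :
    ∃ (m : ℕ) (j : X →ₗ[Aᵐᵒᵖ] (Fin m → LeftDual K A A)), Function.Injective j := by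
  let := restrictedModule K Aᵐᵒᵖ X
  have := isScalarTower_restrictedModule K Aᵐᵒᵖ X
  have : FiniteDimensional K Aᵐᵒᵖ := inferInstance
  have : FiniteDimensional K X := Module.Finite.trans Aᵐᵒᵖ X
  let b := Module.finBasis K X
  refine ⟨_, LinearMap.pi fun i => toDualRegular (b.coord i), ?_⟩
  rw [← LinearMap.ker_eq_bot, LinearMap.ker_eq_bot']
  intro x hx
  refine b.forall_coord_eq_zero_iff.1 fun i => ?_
  have h : b.coord i (op (1 : A) • x) = 0 := DFunLike.congr_fun (congrFun hx i) (1 : A)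
  rwa [MulOpposite.op_one, one_smul] at h

lemma injective_pi {R E : Type u} [Ring R] [AddCommGroup E] [Module R E] [Module.Injective R E]
    (n : ℕ) : Module.Injective R (Fin n → E) where
  out X Y _ _ _ _ f hf g := by
    choose h hh using fun i => Module.Injective.out f hf (LinearMap.proj i ∘ₗ g)
    exact ⟨LinearMap.pi h, fun x => funext fun i => hh i x⟩

instance finite_leftDual [FiniteDimensional K N] : Module.Finite Aᵐᵒᵖ (LeftDual K A N) :=
  have : Module.Finite K (LeftDual K A N) := inferInstanceAs (Module.Finite K (N →ₗ[K] K))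
  Module.Finite.of_restrictScalars_finite K Aᵐᵒᵖ _

lemma enoughFiniteInjectives (K A : Type u) [Field K] [Ring A] [Algebra K A]
    [FiniteDimensional K A] : EnoughFiniteInjectives Aᵐᵒᵖ := by
  intro M _ _ _
  obtain ⟨m, j, hj⟩ := exists_embedding_dualRegular K (A := A) (X := M)
  exact ⟨ModuleCat.of Aᵐᵒᵖ (Fin m → LeftDual K A A), j, hj,
    inferInstanceAs (Module.Finite Aᵐᵒᵖ (Fin m → LeftDual K A A)), injective_pi m⟩

end Duality

/-! ### Bounds on injective dimension. -/

section InjectiveDimension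

variable {R : Type u} [Ring R] {Y : Type u} [AddCommGroup Y] [Module R Y]

lemma injective_of_forall_extVanish_one
    (h : ∀ X : ModuleCat.{u} R, Module.Finite R X → ExtVanish R X Y 1) : Module.Injective R Y := by
  refine Module.Baer.injective fun I g => ?_
  have hI := IsSES.subtype_mkQ (R := R) (M₂ := R) I
  obtain ⟨ψ, hψ⟩ := hI.extend_of_extVanish (h (ModuleCat.of R (R ⧸ I))
    (inferInstanceAs (Module.Finite R (R ⧸ I)))) g
  exact ⟨ψ, fun x hx => LinearMap.congr_fun hψ ⟨x, hx⟩⟩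

lemma exists_injective_ses (R : Type u) [Ring R] (Y : Type u) [AddCommGroup Y] [Module R Y] :
    ∃ (E C : ModuleCat.{u} R) (j : Y →ₗ[R] E) (q : E →ₗ[R] C), IsSES j q ∧
      Module.Injective R E := by
  obtain ⟨E, _, f, hf⟩ := EnoughInjectives.presentation (ModuleCat.of R Y)
  exact ⟨E, ModuleCat.of R (E ⧸ LinearMap.range f.hom), f.hom, _,
    IsSES.mkQ ((ModuleCat.mono_iff_injective f).1 hf),
    Module.injective_module_of_injective_object R E⟩

lemma hasInjectiveDimensionLE_of_forall_finite {n : ℕ}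
    (h : ∀ X : ModuleCat.{u} R, Module.Finite R X → ExtVanish R X Y (n + 1)) :
    HasInjectiveDimensionLE (ModuleCat.of R Y) n := by
  induction n generalizing Y with
  | zero =>
    have := injective_of_forall_extVanish_one h
    rw [HasInjectiveDimensionLE, ← injective_iff_hasInjectiveDimensionLT_one]
    exact Module.injective_object_of_injective_module R Y
  | succ n ih =>
    obtain ⟨E, C, j, q, hses, hE⟩ := exists_injective_ses R Y
    refine (hses.shortExact.hasInjectiveDimensionLT_X₃_iff n
      (Module.injective_object_of_injective_module R E)).1 (ih fun X hX => ?_)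
    exact hses.covariant₃ (extVanish_of_injective n) (h X hX)

lemma extVanish_of_hasInjectiveDimensionLT {n : ℕ}
    (h : HasInjectiveDimensionLT (ModuleCat.of R Y) n) (X : Type u) [AddCommGroup X] [Module R X]
    {i : ℕ} (hi : n ≤ i) : ExtVanish R X Y i :=
  HasInjectiveDimensionLT.subsingleton (ModuleCat.of R Y) n i hi (ModuleCat.of R X)

variable [IsNoetherianRing R] (hR : EnoughFiniteInjectives R)

include hR in
lemma exists_hull_ses [IsArtinianRing R] (M : Type u) [AddCommGroup M] [Module R M]
    [hM : Module.Finite R M] :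
    ∃ (E C : ModuleCat.{u} R) (j : M →ₗ[R] E) (q : E →ₗ[R] C), IsSES j q ∧ Module.Finite R E ∧
      Module.Injective R E ∧ Module.Finite R C ∧
        ∀ k, DomGE R (k + 1) M → Module.Projective R E ∧ DomGE R k C :=
  ⟨_, _, _, _, isSES_hull hR ⟨ModuleCat.of R M, hM⟩, (isFiniteHull_hullMap hR _).finite,
    (isFiniteHull_hullMap hR _).injective, (cosyzygy hR _).2, fun _ hk => DomGE.hull hR hk⟩

include hR in
-- The minimal injective resolution stops while its terms are still projective, so it splits from
-- its end: once the cosyzygy C is projective, M is a summand of its hull.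
lemma projective_and_injective_of_domGE [IsArtinianRing R] {k : ℕ} {M : Type u} [AddCommGroup M]
    [Module R M] [Module.Finite R M] (hd : DomGE R (k + 1) M)
    (h : ∀ X : ModuleCat.{u} R, Module.Finite R X → ExtVanish R X M (k + 1)) :
    Module.Projective R M ∧ Module.Injective R M := by
  induction k generalizing M with
  | zero =>
    obtain ⟨E, C, j, q, hses, _, _, hC, hk⟩ := exists_hull_ses hR M
    obtain ⟨hE, -⟩ := hk 0 hd
    obtain ⟨r, hr⟩ := hses.extend_of_extVanish (h C hC) LinearMap.id
    exact ⟨.of_split j r hr, injective_of_retract j r hr⟩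
  | succ k ih =>
    obtain ⟨E, C, j, q, hses, _, _, hC, hk⟩ := exists_hull_ses hR M
    obtain ⟨hE, hdC⟩ := hk _ hd
    obtain ⟨_, -⟩ := ih hdC fun X hX => hses.covariant₃ (extVanish_of_injective k) (h X hX)
    obtain ⟨r, hr⟩ := hses.extend_of_extVanish (extVanish_of_projective 0) LinearMap.id
    exact ⟨.of_split j r hr, injective_of_retract j r hr⟩

include hR in
-- The hypotheses pass to cosyzygies until Ext² vanishes. Then the cokernel of the hull is itself
-- injective, and Ext¹ from it to M vanishes, so the sequence splits.
lemma extVanish_of_forall_injective [IsArtinianRing R] {n : ℕ} {M : Type u} [AddCommGroup M]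
    [Module R M] [Module.Finite R M]
    (h : ∀ X : ModuleCat.{u} R, Module.Finite R X → ExtVanish R X M (n + 2))
    (hJ : ∀ J : ModuleCat.{u} R, Module.Finite R J → Module.Injective R J →
      ExtVanish R J M (n + 1)) (X : ModuleCat.{u} R) :
    ExtVanish R X M (n + 1) := by
  induction n generalizing M with
  | zero =>
    obtain ⟨E, C, j, q, hses, _, _, hC, -⟩ := exists_hull_ses hR M
    have hCi : Module.Injective R C := injective_of_forall_extVanish_one fun X hX =>
      hses.covariant₃ (extVanish_of_injective 0) (h X hX)
    obtain ⟨r, hr⟩ := hses.extend_of_extVanish (hJ C hC hCi) LinearMap.id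
    have := injective_of_retract j r hr
    exact extVanish_of_injective 0
  | succ n ih =>
    obtain ⟨E, C, j, q, hses, _, _, hC, -⟩ := exists_hull_ses hR M
    exact hses.covariant₁ (ih
      (fun X hX => hses.covariant₃ (extVanish_of_injective (n + 1)) (h X hX))
      fun J hJf hJi => hses.covariant₃ (extVanish_of_injective n) (hJ J hJf hJi))
      (extVanish_of_injective (n + 1))

/-- Each syzygy raises the dominant dimension by one, so after d steps `base` applies. It is used
with Φ trivial for the right injective dimension of A, and with Φ = `IsGProjOrthogonal` for the
projective dimension of D(A). -/
lemma extVanish_of_syzygy_closed {d : ℕ} (hR' : DomGE R d R) {Z : Type u} [AddCommGroup Z]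
    [Module R Z] (Φ : ModuleCat.{u} R → Prop)
    (hΦ : ∀ X : ModuleCat.{u} R, Φ X → ∀ (n : ℕ) (g : (Fin n → R) →ₗ[R] X),
      Function.Surjective g → Φ (ModuleCat.of R (LinearMap.ker g)))
    (base : ∀ X : ModuleCat.{u} R, Module.Finite R X → Φ X → DomGE R d X →
      ∀ i, 1 ≤ i → ExtVanish R X Z i)
    (X : ModuleCat.{u} R) (hX : Module.Finite R X) (hXΦ : Φ X) {i : ℕ} (hi : d + 1 ≤ i) :
    ExtVanish R X Z i := by
  suffices key : ∀ k ≤ d, ∀ X : ModuleCat.{u} R, Module.Finite R X → Φ X → DomGE R (d - k) X →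
      ∀ i, k + 1 ≤ i → ExtVanish R X Z i from
    -- For k = d the condition `DomGE R (d - k) X` is vacuous.
    key d le_rfl X hX hXΦ (fun _ _ i hi => by lia) i hi
  intro k hk
  induction k with
  | zero => exact fun X hX hΦX hdX i hi => base X hX hΦX hdX i (by lia)
  | succ k ih =>
    intro X hX hΦX hdX i hi
    obtain ⟨n, g, hg⟩ := Module.Finite.exists_fin' R X
    have hses := IsSES.ker hg
    have : IsNoetherian R (Fin n → R) := inferInstance
    obtain ⟨i, rfl⟩ : ∃ j, i = j + 1 := ⟨i - 1, by lia⟩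
    refine hses.contravariant₃ (ih (by lia) (ModuleCat.of R (LinearMap.ker g))
      (inferInstanceAs (Module.Finite R (LinearMap.ker g))) (hΦ X hΦX n g hg) ?_ i (by lia))
      (extVanish_of_projective i)
    have hs : d - k = d - (k + 1) + 1 := by lia
    rw [hs]
    exact DomGE.of_ses hses ((DomGE.of_finite_projective hR').mono (by lia)) hdX

end InjectiveDimension

/-! ### Gorenstein projectives versus dominant dimension. -/

section RightModules

variable {A : Type u} [Ring A]

lemma DomGE.rightRegular {n : ℕ} (h : DomGE Aᵐᵒᵖ n A) : DomGE Aᵐᵒᵖ n Aᵐᵒᵖ :=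
  fun T hT i hi => (h T hT i hi).congr_right (unopLinearEquiv A)

lemma ExtVanish.of_finite_free {X : Type u} [AddCommGroup X] [Module Aᵐᵒᵖ X] {i : ℕ}
    (h : ExtVanish Aᵐᵒᵖ X A i) (n : ℕ) : ExtVanish Aᵐᵒᵖ X (Fin n → Aᵐᵒᵖ) i :=
  (h.congr_right (unopLinearEquiv A)).pi_right n

lemma IsGProj.domGE [IsNoetherianRing A] {d : ℕ} (hA : DomGE Aᵐᵒᵖ d A) {M : Type u}
    [AddCommGroup M] [Module Aᵐᵒᵖ M] (hM : IsGProj A M) : DomGE Aᵐᵒᵖ d M := by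
  suffices key : ∀ k ≤ d, ∀ M : ModuleCat.{u} Aᵐᵒᵖ, IsGProj A M → DomGE Aᵐᵒᵖ k M from
    key d le_rfl (ModuleCat.of _ M) hM
  intro k hk
  induction k with
  | zero => exact fun _ _ _ _ i hi => absurd hi (Nat.not_lt_zero i)
  | succ k ih =>
    intro M hM
    obtain ⟨n, C, j, q, hses, hC⟩ := hM.exists_cosyzygy
    exact .of_ses hses ((DomGE.of_finite_projective hA.rightRegular).mono hk) (ih (by lia) C hC)

/-- `Extⁱ(C, X) = 0` for all Gorenstein projective `C` and all `i ≥ 1`. -/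
def IsGProjOrthogonal (X : ModuleCat.{u} Aᵐᵒᵖ) : Prop :=
  ∀ C : ModuleCat.{u} Aᵐᵒᵖ, IsGProj A C → ∀ i, 1 ≤ i → ExtVanish Aᵐᵒᵖ C X i

/-- Embed C into a free module with Gorenstein projective cokernel C'. Then Extⁱ(C, ΩX) is
controlled by Extⁱ⁺¹(C', ΩX), which lies between Extⁱ(C', X) = 0 and Extⁱ⁺¹(C', free) = 0. -/
lemma IsGProjOrthogonal.syzygy [IsNoetherianRing A] (X : ModuleCat.{u} Aᵐᵒᵖ)
    (hX : IsGProjOrthogonal X) (n : ℕ) (g : (Fin n → Aᵐᵒᵖ) →ₗ[Aᵐᵒᵖ] X)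
    (hg : Function.Surjective g) :
    IsGProjOrthogonal (ModuleCat.of Aᵐᵒᵖ (LinearMap.ker g)) := by
  intro C hC i hi
  obtain ⟨m, C', j, q, hses, hC'⟩ := hC.exists_cosyzygy
  exact hses.contravariant₁ (extVanish_of_pos_of_projective hi)
    ((IsSES.ker hg).covariant₁ (hX C' hC' i hi)
      ((hC'.ext_eq_zero (i + 1) (by lia)).of_finite_free n))

/-- Replacing M by its syzygy, the range of f, raises the degree of Ext of the transpose by one and
preserves the vanishing of Extⁱ(M, A). After at most d replacements the degree exceeds d. -/
lemma extVanish_Tr [IsNoetherianRing Aᵐᵒᵖ] {d : ℕ}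
    (hA : ∀ N : ModuleCat.{u} A, ∀ i, d + 1 ≤ i → ExtVanish A N A i)
    {M P₁ P₀ : ModuleCat.{u} Aᵐᵒᵖ} (hM : ∀ i, 1 ≤ i → ExtVanish Aᵐᵒᵖ M A i)
    [Module.Finite Aᵐᵒᵖ P₀] [Module.Projective Aᵐᵒᵖ P₀] [Module.Finite Aᵐᵒᵖ P₁]
    [Module.Projective Aᵐᵒᵖ P₁] {f : P₁ →ₗ[Aᵐᵒᵖ] P₀} {π : P₀ →ₗ[Aᵐᵒᵖ] M}
    (hπ : Function.Surjective π) (hf : LinearMap.range f = LinearMap.ker π) : TrVanish f := by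
  suffices key : ∀ (k : ℕ) (M P₁ P₀ : ModuleCat.{u} Aᵐᵒᵖ) (f : P₁ →ₗ[Aᵐᵒᵖ] P₀)
      (π : P₀ →ₗ[Aᵐᵒᵖ] M), (∀ i, 1 ≤ i → ExtVanish Aᵐᵒᵖ M A i) → Module.Finite Aᵐᵒᵖ P₁ →
      Module.Projective Aᵐᵒᵖ P₁ → Module.Projective Aᵐᵒᵖ P₀ → Function.Surjective π →
      LinearMap.range f = LinearMap.ker π → ∀ i, 1 ≤ i → d + 1 ≤ i + k → ExtVanish A (Tr f) A i from
    fun i hi => key d M P₁ P₀ f π hM ‹_› ‹_› ‹_› hπ hf i hi (by lia)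
  intro k
  induction k with
  | zero => exact fun M P₁ P₀ f π _ _ _ _ _ _ i _ hi => hA (ModuleCat.of A (Tr f)) i hi
  | succ k ih =>
    intro M P₁ P₀ f π hM _ _ _ hπ hf i hi hik
    obtain ⟨n, g, hg⟩ := Module.Finite.exists_fin' Aᵐᵒᵖ (LinearMap.ker f)
    have hg' : LinearMap.range ((LinearMap.ker f).subtype ∘ₗ g) = LinearMap.ker f := by
      rw [LinearMap.range_comp, LinearMap.range_eq_top.2 hg, Submodule.map_top,
        Submodule.range_subtype]
    have hses : IsSES (LinearMap.range f).subtype π :=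
      .of_range_eq_ker (Submodule.injective_subtype _) hπ (by rw [Submodule.range_subtype, hf])
    refine extVanish_Tr_of_syzygy hg' hf hπ (hM 1 le_rfl) hi
      (ih (ModuleCat.of Aᵐᵒᵖ (LinearMap.range f)) (ModuleCat.of Aᵐᵒᵖ (Fin n → Aᵐᵒᵖ)) P₁ _
        f.rangeRestrict (fun i hi => ?_) (inferInstanceAs (Module.Finite Aᵐᵒᵖ (Fin n → Aᵐᵒᵖ)))
        (inferInstanceAs (Module.Projective Aᵐᵒᵖ (Fin n → Aᵐᵒᵖ))) ‹_›
        f.surjective_rangeRestrict (by rw [LinearMap.ker_rangeRestrict, hg']) (i + 1) (by lia)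
        (by lia))
    exact hses.contravariant₁ (extVanish_of_pos_of_projective hi) (hM (i + 1) (by lia))

lemma extVanish_of_domGE [IsNoetherianRing Aᵐᵒᵖ] [IsArtinianRing Aᵐᵒᵖ]
    (hE : EnoughFiniteInjectives Aᵐᵒᵖ) {d : ℕ}
    (hA : ∀ X : ModuleCat.{u} Aᵐᵒᵖ, ∀ i, d + 1 ≤ i → ExtVanish Aᵐᵒᵖ X A i) {M : Type u}
    [AddCommGroup M] [Module Aᵐᵒᵖ M] [Module.Finite Aᵐᵒᵖ M] (hM : DomGE Aᵐᵒᵖ d M) {i : ℕ}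
    (hi : 1 ≤ i) : ExtVanish Aᵐᵒᵖ M A i := by
  suffices key : ∀ (k : ℕ) (M : ModuleCat.{u} Aᵐᵒᵖ), Module.Finite Aᵐᵒᵖ M → DomGE Aᵐᵒᵖ k M →
      ∀ i, 1 ≤ i → d + 1 ≤ i + k → ExtVanish Aᵐᵒᵖ M A i from
    key d (ModuleCat.of _ M) ‹_› hM i hi (by lia)
  intro k
  induction k with
  | zero => exact fun M _ _ i _ hi => hA M i hi
  | succ k ih =>
    intro M _ hM i hi hik
    obtain ⟨E, C, j, q, hses, _, _, hC, hk⟩ := exists_hull_ses hE M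
    obtain ⟨_, hdC⟩ := hk k hM
    exact hses.contravariant₁ (extVanish_of_pos_of_projective hi)
      (ih C hC hdC (i + 1) (by lia) (by lia))

end RightModules

/-! ### The lower bounds and the equivalence. -/

section Main

lemma artinian_noetherian_of_finiteDimensional (K A : Type u) [Field K] [Ring A] [Algebra K A]
    [FiniteDimensional K A] : IsNoetherianRing A ∧ IsNoetherianRing Aᵐᵒᵖ ∧
    IsArtinianRing Aᵐᵒᵖ :=
  ⟨.of_finite K A, .of_finite K Aᵐᵒᵖ, .of_finite K Aᵐᵒᵖ⟩

lemma dom_iff (K : Type u) {A : Type u} [Field K] [Ring A] [Algebra K A]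
    [FiniteDimensional K A] (d : ℕ) (M : ModuleCat.{u} Aᵐᵒᵖ) :
    Dom A d M ↔ Module.Finite Aᵐᵒᵖ M ∧ DomGE Aᵐᵒᵖ d M := by
  obtain ⟨_, _, _⟩ := artinian_noetherian_of_finiteDimensional K A
  exact and_congr_right fun hM =>
    ⟨domGE_of_le_domdim, le_domdim_of_domGE (enoughFiniteInjectives K A) hM⟩

lemma not_projective_and_injective (K : Type u) {A : Type u} [Field K] [Ring A] [Algebra K A]
    [FiniteDimensional K A] {d : ℕ} (hA : algDomdim A = d) :
    ¬ (Module.Projective Aᵐᵒᵖ A ∧ Module.Injective Aᵐᵒᵖ A) := by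
  obtain ⟨_, _, _⟩ := artinian_noetherian_of_finiteDimensional K A
  rintro ⟨_, _⟩
  -- A projective-injective module satisfies `DomGE` for every n; n = d + 1 already contradicts
  -- dominant dimension d.
  have := le_domdim_of_domGE (enoughFiniteInjectives K A) (M := rightRegular A)
    (inferInstanceAs (Module.Finite Aᵐᵒᵖ A)) (domGE_of_projective_injective (E := A) (d + 1))
  rw [show domdim (rightRegular A) = d from hA] at this
  exact absurd (Nat.cast_le.1 this) (by lia)

lemma not_hasInjectiveDimensionLT_right (K : Type u) {A : Type u} [Field K] [Ring A] [Algebra K A]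
    [FiniteDimensional K A] {d : ℕ} (hd : 1 ≤ d) (hA : algDomdim A = d) :
    ¬ HasInjectiveDimensionLT (rightRegular A) d := by
  obtain ⟨_, _, _⟩ := artinian_noetherian_of_finiteDimensional K A
  obtain ⟨k, rfl⟩ := Nat.exists_eq_add_of_le' hd
  exact fun h => not_projective_and_injective K hA
    (projective_and_injective_of_domGE (enoughFiniteInjectives K A)
      (domGE_of_le_domdim (M := rightRegular A) hA.ge)
      fun X _ => extVanish_of_hasInjectiveDimensionLT h X le_rfl)

lemma extVanish_left_regular_iff {K A : Type u} [Field K] [Ring A] [Algebra K A]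
    [FiniteDimensional K A]
    {N : Type u} [AddCommGroup N] [Module K N] [Module A N]
    [IsScalarTower K A N] {i : ℕ} (hi : 1 ≤ i) :
    ExtVanish A N A i ↔ ExtVanish Aᵐᵒᵖ (LeftDual K A A) (LeftDual K A N) i := by
  rw [← extVanish_rightDual_iff hi]
  exact ⟨fun h => h.congr_right (leftBidual (K := K)).symm,
    fun h => h.congr_right (leftBidual (K := K))⟩

lemma extVanish_dualRegular {K A : Type u} [Field K] [Ring A] [Algebra K A]
    [FiniteDimensional K A] {i : ℕ} (hi : 1 ≤ i)
    (h : ∀ N : ModuleCat.{u} A, ExtVanish A N A i) :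
    ExtVanish Aᵐᵒᵖ (LeftDual K A A) A i :=
  ((extVanish_left_regular_iff hi).1 (h (ModuleCat.of A (RightDual K A A)))).congr_right
    (rightBidual (K := K))

/-- Left injective dimension below d gives Extᵈ(D(A), A) = 0 by duality, hence Extᵈ(J, A) = 0 for
every finitely generated injective J, a summand of a power of D(A). Since the right injective
dimension is at most d, it would then be less than d. -/
lemma not_hasInjectiveDimensionLT_left (K : Type u) {A : Type u} [Field K] [Ring A] [Algebra K A]
    [FiniteDimensional K A] {d : ℕ} (hd : 1 ≤ d) (hA : algDomdim A = d)
    (hr : HasInjectiveDimensionLE (rightRegular A) d) :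
    ¬ HasInjectiveDimensionLT (leftRegular A) d := by
  obtain ⟨_, _, _⟩ := artinian_noetherian_of_finiteDimensional K A
  obtain ⟨k, rfl⟩ := Nat.exists_eq_add_of_le' hd
  intro h
  have h1 : ExtVanish Aᵐᵒᵖ (LeftDual K A A) A (k + 1) :=
    extVanish_dualRegular hd fun N => extVanish_of_hasInjectiveDimensionLT h N le_rfl
  refine not_hasInjectiveDimensionLT_right K hd hA
    (hasInjectiveDimensionLE_of_forall_finite fun X _ => ?_)
  refine extVanish_of_forall_injective (enoughFiniteInjectives K A)
    (fun X _ => extVanish_of_hasInjectiveDimensionLT hr X le_rfl) (fun J _ _ => ?_) X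
  obtain ⟨m, j, hj⟩ := exists_embedding_dualRegular K (A := A) (X := J)
  obtain ⟨r, hr⟩ := exists_extension j hj LinearMap.id
  exact (h1.pi_left m).retract_left j r hr

theorem gp_eq_dom_iff (K : Type u) {A : Type u} [Field K] [Ring A] [Algebra K A]
    [FiniteDimensional K A] (d : ℕ) (hd : 1 ≤ d) (hA : algDomdim A = d) :
    Gp A = Dom A d ↔ IsGorensteinOfDim A d := by
  obtain ⟨_, _, _⟩ := artinian_noetherian_of_finiteDimensional K A
  have hdA : DomGE Aᵐᵒᵖ d A := domGE_of_le_domdim (M := rightRegular A) hA.ge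
  constructor
  · intro h
    have hG (M : ModuleCat.{u} Aᵐᵒᵖ) (hM : Module.Finite Aᵐᵒᵖ M) (hMd : DomGE Aᵐᵒᵖ d M) :
        IsGProj A M :=
      isGProj_of_mem_Gp (by rw [h]; exact (dom_iff K d M).2 ⟨hM, hMd⟩)
    have hr : HasInjectiveDimensionLE (rightRegular A) d :=
      hasInjectiveDimensionLE_of_forall_finite fun X hX =>
        extVanish_of_syzygy_closed hdA.rightRegular (fun _ => True) (fun _ _ _ _ _ => trivial)
          (fun X hX _ hdX => (hG X hX hdX).ext_eq_zero) X hX trivial le_rfl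
    have hpd (Z : ModuleCat.{u} Aᵐᵒᵖ) : ExtVanish Aᵐᵒᵖ (LeftDual K A A) Z (d + 1) := by
      refine extVanish_of_syzygy_closed hdA.rightRegular IsGProjOrthogonal
        IsGProjOrthogonal.syzygy (fun X hX hXo hdX i hi => ?_)
        (ModuleCat.of Aᵐᵒᵖ (LeftDual K A A)) (inferInstanceAs (Module.Finite _ (LeftDual K A A)))
        (fun C _ i hi => extVanish_of_pos_of_injective (Y := LeftDual K A A) hi) le_rfl
      -- X is both Gorenstein projective and orthogonal to the cokernel C, so its embedding into a
      -- free module splits.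
      obtain ⟨n, C, j, q, hses, hC⟩ := (hG X hX hdX).exists_cosyzygy
      obtain ⟨r, hr⟩ := hses.extend_of_extVanish (hXo C hC 1 le_rfl) LinearMap.id
      have : Module.Projective Aᵐᵒᵖ X := .of_split j r hr
      exact extVanish_of_pos_of_projective hi
    have hl : HasInjectiveDimensionLE (leftRegular A) d :=
      hasInjectiveDimensionLE_of_forall_finite fun N _ => by
        let := restrictedModule K A N
        have := isScalarTower_restrictedModule K A N
        exact (extVanish_left_regular_iff (K := K) (by lia)).2
          (hpd (ModuleCat.of Aᵐᵒᵖ (LeftDual K A N)))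
    exact ⟨le_antisymm ((injectiveDimension_le_iff _ _).2 hl)
        ((injectiveDimension_ge_iff _ _).2 (not_hasInjectiveDimensionLT_left K hd hA hr)),
      le_antisymm ((injectiveDimension_le_iff _ _).2 hr)
        ((injectiveDimension_ge_iff _ _).2 (not_hasInjectiveDimensionLT_right K hd hA))⟩
  · rintro ⟨hl, hr⟩
    have hl' := (injectiveDimension_le_iff _ _).1 hl.le
    have hr' := (injectiveDimension_le_iff _ _).1 hr.le
    funext M
    refine propext ⟨fun hM => (dom_iff K d M).2 ⟨hM.1, (isGProj_of_mem_Gp hM).domGE hdA⟩,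
      fun hM => ?_⟩
    obtain ⟨hMf, hMd⟩ := (dom_iff K d M).1 hM
    have hext : ∀ i, 1 ≤ i → ExtVanish Aᵐᵒᵖ M A i := fun i hi =>
      extVanish_of_domGE (enoughFiniteInjectives K A)
        (fun X i hi => extVanish_of_hasInjectiveDimensionLT hr' X hi) hMd hi
    obtain ⟨p, hp₀, hp₁⟩ := exists_minimalPresentation hMf
    have := p.projective₀
    have := p.projective₁
    exact ⟨hMf, hext, p, extVanish_Tr
      (fun N i hi => extVanish_of_hasInjectiveDimensionLT hl' N hi) hext p.surjective p.exact⟩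

end Main

/-- The duality needs the field in the universe of A. If A is nonzero, K embeds into A and can be
shrunk; over the zero ring any field serves, and ℚ is taken. -/
lemma exists_small_field (K : Type v) (A : Type u) [Field K] [Ring A] [Algebra K A]
    [FiniteDimensional K A] :
    ∃ (k : Type u) (_ : Field k) (_ : Algebra k A), FiniteDimensional k A := by
  cases subsingleton_or_nontrivial A with
  | inl h =>
    let φ : ULift.{u} ℚ →+* A :=
      { toFun := fun _ => 0
        map_one' := Subsingleton.elim _ _
        map_mul' := fun _ _ => Subsingleton.elim _ _
        map_zero' := rfl
        map_add' := fun _ _ => Subsingleton.elim _ _ }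
    let := φ.toAlgebra' fun _ _ => Subsingleton.elim _ _
    exact ⟨ULift.{u} ℚ, inferInstance, this, inferInstance⟩
  | inr h =>
    have : Small.{u} K := small_of_injective (algebraMap K A).injective
    let e := (Shrink.ringEquiv.{u} K).symm
    let : Algebra (Shrink.{u} K) A := Algebra.compHom A e.symm.toRingHom
    refine ⟨Shrink.{u} K, inferInstance, this, ?_⟩
    obtain ⟨s, hs⟩ := Module.finite_def.1 ‹FiniteDimensional K A›
    refine ⟨s, eq_top_iff.2 fun x _ => ?_⟩
    have hx : x ∈ Submodule.span K (s : Set A) := hs ▸ Submodule.mem_top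
    induction hx using Submodule.span_induction with
    | mem x hx => exact Submodule.subset_span hx
    | zero => exact zero_mem _
    | add x y _ _ hx hy => exact add_mem (hx trivial) (hy trivial)
    | smul a x _ hx =>
      have : a • x = e a • x := by
        change a • x = e.symm (e a) • x
        rw [e.symm_apply_apply]
      rw [this]
      exact Submodule.smul_mem _ _ (hx trivial)

end GorDom

theorem mainTheorem8 {K : Type v} {A : Type u} [Field K] [Ring A] [Algebra K A]
    [FiniteDimensional K A] (d : ℕ) (hd : 1 ≤ d) (hA : GorDom.algDomdim A = d) :
    GorDom.Gp A = GorDom.Dom A d ↔ GorDom.IsGorensteinOfDim A d := by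
  obtain ⟨k, _, _, _⟩ := GorDom.exists_small_field K A
  exact GorDom.gp_eq_dom_iff k d hd hA
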